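/- Let $d\in\{2,3\}$, $k\ge 1$, $\rho>0$, $\gamma\in\mathbb R$ and $N\in\mathbb N$. There is a constant $\beta>0$, depending only on $d,k,\rho,\gamma,N$, such that the following holds. Let $\Omega\subset\mathbb R^d$ be a nonempty bounded connected open set and $\mathcal T_h$ a finite partition of $\overline\Omega$ into (not necessarily convex) polygons ($d=2$) or polyhedra ($d=3$) with set $\mathcal E_h$ of edges or flat faces, each of which lies in $\partial\Omega$ or has its relative interior in $\Omega$. (The boundary of each element is a union of members of $\mathcal E_h$; distinct elements have disjoint interiors and distinct faces disjoint relative interiors; each element lies on one side of each of its faces.) Let $h_T$ be the diameter of $T$ and $h=\max_T h_T$, and assume that every $T\in\mathcal T_h$ satisfies $|T|\ge\rho\,h_T^d$, has at most $N$ faces, and satisfies $h\le\gamma h_T$. Let - $V_h$ be the space of pairs $v=\{v_0,v_b\}$ with $v_0|_T\in[P_k(T)]^d$ for $T\in\mathcal T_h$ and, for $e\in\mathcal E_h$, a single-valued $v_b|_e\in V_{k-1}(e):=[P_{k-1}(e)]^d+P_{RM}(e)$, where $P_{RM}(e)$ consists of the restrictions to $e$ of the rigid motions $x\mapsto a+\eta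 x$, $a\in\mathbb R^d$, $\eta\in so(d)$; $V_h^0=\{v\in V_h: v_b=0\text{ on }\partial\Omega\}$; - $W_h^0$ be the space of functions $q$ with $q|_T\in P_{k-1}(T)$ for all $T\in\mathcal T_h$ and $\int_\Omega q=0$; - $\nabla_w\cdot v$ be the discrete weak divergence: $(\nabla_w\cdot v)|_T\in P_{k-1}(T)$ and $(\nabla_w\cdot v,\varphi)_T=-(v_0,\nabla\varphi)_T+\langle v_b\cdot n,\varphi\rangle_{\partial T}$ for all $\varphi\in P_{k-1}(T)$, with $n$ the outward unit normal of $T$; - $b(v,q)=\sum_{T}(\nabla_w\cdot v,q)_T$; - $|||v|||^2=\sum_T\big(\|\varepsilon(v_0)\|_T^2+h_T^{-1}\|Q_bv_0-v_b\|_{\partial T}^2\big)$, where $\varepsilon(v_0)=\frac12(\nabla v_0+\nabla v_0^T)$ and $Q_b$ is on each face $e$ the $L^2(e)$ projection onto $V_{k-1}(e)$; - $|||q|||_0^2=h\sum_{e\in\mathcal E_h^0}\|[\![q]\!]_e\|_e^2+h^2\sum_{T}\|\nabla q\|_T^2$, where $\mathcal E_h^0$ is the set of faces not contained in $\partial\Omega$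 and $[\![q]\!]_e$ is the jump of $q$ across $e$. Then $$\sup_{v\in V_h^0,\ v\ne 0}\frac{b(v,q)}{|||v|||}\ \ge\ \beta\,|||q|||_0\qquad\text{for all } q\in W_h^0 .$$ -/

import Mathlib

open Filter Topology MeasureTheory

noncomputable section

namespace WGElasticity

/-- The Euclidean space `ℝᵈ`. -/
abbrev Pt (d : ℕ) : Type := EuclideanSpace ℝ (Fin d)

/-! ### Polynomials -/

/-- The value at `x` of a polynomial vector field. -/
def evalVec {d : ℕ} (p : Fin d → MvPolynomial (Fin d) ℝ) (x : Pt d) : Pt d :=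
  WithLp.toLp 2 fun i => MvPolynomial.eval (fun j => x j) (p i)

/-- The value at `x` of a scalar polynomial. -/
def evalPoly {d : ℕ} (q : MvPolynomial (Fin d) ℝ) (x : Pt d) : ℝ :=
  MvPolynomial.eval (fun j => x j) q

/-- The gradient `∇ q` at `x`. -/
def gradPoly {d : ℕ} (q : MvPolynomial (Fin d) ℝ) (x : Pt d) : Pt d :=
  evalVec (fun i => MvPolynomial.pderiv i q) x

/-- The strain tensor `ε(p) = (∇ p + (∇ p)ᵀ) / 2` at `x`. -/
def strain {d : ℕ} (p : Fin d → MvPolynomial (Fin d) ℝ) (x : Pt d) :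
    Matrix (Fin d) (Fin d) ℝ :=
  Matrix.of fun i j =>
    (1 / 2 : ℝ) * (evalPoly (MvPolynomial.pderiv j (p i)) x
      + evalPoly (MvPolynomial.pderiv i (p j)) x)

/-! ### Polytopes and polytopal partitions -/

/-- `P` is a closed, not necessarily convex, polytope of dimension `n` in `ℝᵈ` (a segment, a
polygon, a polyhedron for `n = 1, 2, 3`): a finite union of convex hulls of finite sets that spans
an affine subspace of dimension `n`, is the closure of its relative interior, and whose relative
interior is nonempty and connected. -/
structure IsPolytope {d : ℕ} (n : ℕ) (P : Set (Pt d)) : Prop where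
  finite_union : ∃ S : Finset (Finset (Pt d)), P = ⋃ s ∈ S, convexHull ℝ (s : Set (Pt d))
  dim_eq : Module.finrank ℝ (affineSpan ℝ P).direction = n
  closure_eq : closure (intrinsicInterior ℝ P) = P
  connected : IsConnected (intrinsicInterior ℝ P)

/-- `ν` is the unit normal of the flat face `e` pointing out of `T`. -/
structure IsOutwardNormal {d : ℕ} (T e : Set (Pt d)) (ν : Pt d) : Prop where
  norm_eq : ‖ν‖ = 1
  orthogonal : ∀ w ∈ (affineSpan ℝ e).direction, inner ℝ ν w = 0
  inside : ∀ x ∈ intrinsicInterior ℝ e, ∀ᶠ t : ℝ in 𝓝[>] 0, x - t • ν ∈ interior T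
  outside : ∀ x ∈ intrinsicInterior ℝ e, ∀ᶠ t : ℝ in 𝓝[>] 0, x + t • ν ∉ T

/-- A finite partition of `Ω` into polygons (`d = 2`) or polyhedra (`d = 3`), with its set of
edges (`d = 2`) or flat faces (`d = 3`). -/
structure PolyMesh {d : ℕ} (Ω : Set (Pt d)) where
  /-- the elements, the set `𝒯_h` -/
  elems : Finset (Set (Pt d))
  /-- the edges or faces, the set `ℰ_h` -/
  faces : Finset (Set (Pt d))
  elem_polytope : ∀ T ∈ elems, IsPolytope d T
  face_polytope : ∀ e ∈ faces, IsPolytope (d - 1) e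
  cover : ⋃ T ∈ elems, T = closure Ω
  interior_subset : ∀ T ∈ elems, interior T ⊆ Ω
  elem_disjoint : ∀ T ∈ elems, ∀ T' ∈ elems, T ≠ T' → Disjoint (interior T) (interior T')
  face_disjoint : ∀ e ∈ faces, ∀ e' ∈ faces, e ≠ e' →
    Disjoint (intrinsicInterior ℝ e) (intrinsicInterior ℝ e')
  /-- the boundary of an element is the union of the mesh faces that it contains -/
  frontier_eq : ∀ T ∈ elems, frontier T = ⋃ e ∈ faces, ⋃ _ : e ⊆ frontier T, e
  /-- every mesh face is a face of an element -/
  face_of_elem : ∀ e ∈ faces, ∃ T ∈ elems, e ⊆ frontier T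
  /-- an element lies on one side of each of its faces -/
  exists_normal : ∀ T ∈ elems, ∀ e ∈ faces, e ⊆ frontier T → ∃ ν, IsOutwardNormal T e ν
  /-- a mesh face lies in `∂Ω`, or it is interior to `Ω` up to its relative boundary -/
  face_boundary : ∀ e ∈ faces, e ⊆ frontier Ω ∨ intrinsicInterior ℝ e ⊆ Ω

open scoped Classical in
/-- The unit normal of `e` pointing out of `T` (it is unique where it exists). -/
def outwardNormal {d : ℕ} (T e : Set (Pt d)) : Pt d :=
  if h : ∃ ν, IsOutwardNormal T e ν then h.choose else 0

/-- The integral over a subset `e` of a hyperplane with respect to the `(d-1)`-dimensional surface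
measure (the Hausdorff measure with Euclidean normalization). -/
def faceIntegral {d : ℕ} (e : Set (Pt d)) (f : Pt d → ℝ) : ℝ :=
  ∫ x in e, f x ∂(Measure.euclideanHausdorffMeasure (d - 1) : Measure (Pt d))

/-! ### Function spaces on a face -/

/-- `[P_n(e)]^d`. A vector field on `e` is represented by its extension by zero to `ℝᵈ`. -/
def polyTrace {d : ℕ} (n : ℕ) (e : Set (Pt d)) : Submodule ℝ (Pt d → Pt d) where
  carrier := {v | ∃ p : Fin d → MvPolynomial (Fin d) ℝ,
    (∀ i, p i ∈ MvPolynomial.restrictTotalDegree (Fin d) ℝ n) ∧ v = e.indicator (evalVec p)}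
  add_mem' := by
    rintro _ _ ⟨p, hp, rfl⟩ ⟨p', hp', rfl⟩
    refine ⟨p + p', fun i => Submodule.add_mem _ (hp i) (hp' i), ?_⟩
    funext x
    by_cases hx : x ∈ e
    · ext i
      simp [hx, evalVec]
    · simp [hx]
  zero_mem' := by
    refine ⟨0, fun i => Submodule.zero_mem _, ?_⟩
    funext x
    by_cases hx : x ∈ e
    · ext i
      simp [hx, evalVec]
    · simp [hx]
  smul_mem' := by
    rintro c _ ⟨p, hp, rfl⟩
    refine ⟨c • p, fun i => Submodule.smul_mem _ c (hp i), ?_⟩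
    funext x
    by_cases hx : x ∈ e
    · ext i
      simp [hx, evalVec]
    · simp [hx]

/-- The rigid motion `x ↦ a + η x`. -/
def rigidMotion {d : ℕ} (a : Pt d) (η : Matrix (Fin d) (Fin d) ℝ) (x : Pt d) : Pt d :=
  a + WithLp.toLp 2 (η.mulVec fun j => x j)

/-- `P_RM(e)`, the traces on `e` of the rigid motions `a + η x` with `η` skew-symmetric. -/
def rmTrace {d : ℕ} (e : Set (Pt d)) : Submodule ℝ (Pt d → Pt d) where
  carrier := {v | ∃ (a : Pt d) (η : Matrix (Fin d) (Fin d) ℝ),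
    η.transpose = -η ∧ v = e.indicator (rigidMotion a η)}
  add_mem' := by
    rintro _ _ ⟨a, η, hη, rfl⟩ ⟨a', η', hη', rfl⟩
    refine ⟨a + a', η + η', by rw [Matrix.transpose_add, hη, hη', neg_add], ?_⟩
    funext x
    by_cases hx : x ∈ e
    · ext i
      simp [hx, rigidMotion, Matrix.add_mulVec]
      ring
    · simp [hx]
  zero_mem' := by
    refine ⟨0, 0, by simp, ?_⟩
    funext x
    by_cases hx : x ∈ e
    · ext i
      simp [hx, rigidMotion]
    · simp [hx]
  smul_mem' := by
    rintro c _ ⟨a, η, hη, rfl⟩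
    refine ⟨c • a, c • η, by rw [Matrix.transpose_smul, hη, smul_neg], ?_⟩
    funext x
    by_cases hx : x ∈ e
    · ext i
      simp [hx, rigidMotion, Matrix.smul_mulVec]
    · simp [hx]

/-- `V_{k-1}(e) = [P_{k-1}(e)]^d + P_RM(e)`. -/
def faceSpace {d : ℕ} (k : ℕ) (e : Set (Pt d)) : Submodule ℝ (Pt d → Pt d) :=
  polyTrace (k - 1) e ⊔ rmTrace e

/-- `u` is the `L²(e)`-orthogonal projection of `w` onto `V_{k-1}(e)`. -/
def IsFaceProj {d : ℕ} (k : ℕ) (e : Set (Pt d)) (w u : Pt d → Pt d) : Prop :=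
  u ∈ faceSpace k e ∧ ∀ z ∈ faceSpace k e, faceIntegral e (fun x => inner ℝ (w x - u x) (z x)) = 0

open scoped Classical in
/-- The `L²` projection `Q_b w` of `w` onto `V_{k-1}(e)`. -/
def faceProj {d : ℕ} (k : ℕ) (e : Set (Pt d)) (w : Pt d → Pt d) : Pt d → Pt d :=
  if h : ∃ u, IsFaceProj k e w u then h.choose else 0

namespace PolyMesh

variable {d : ℕ} {Ω : Set (Pt d)} (M : PolyMesh Ω)

open scoped Classical in
/-- The faces of the element `T`. -/
def facesOf (T : M.elems) : Finset M.faces :=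
  Finset.univ.filter fun e => (e : Set (Pt d)) ⊆ frontier (T : Set (Pt d))

open scoped Classical in
/-- The elements that have `e` as a face. -/
def elemsOf (e : M.faces) : Finset M.elems :=
  Finset.univ.filter fun T => (e : Set (Pt d)) ⊆ frontier (T : Set (Pt d))

open scoped Classical in
/-- The interior faces `ℰ_h⁰`. -/
def interiorFaces : Finset M.faces :=
  Finset.univ.filter fun e => ¬ (e : Set (Pt d)) ⊆ frontier Ω

/-- The mesh size `h = max_T h_T`, with `h_T` the diameter of `T`. -/
def meshSize : ℝ := ⨆ T : M.elems, Metric.diam (T : Set (Pt d))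

/-- Shape regularity with constants `ρ` and `N`: every element satisfies `|T| ≥ ρ h_T^d`
and has at most `N` faces. -/
def IsShapeRegular (ρ : ℝ) (N : ℕ) : Prop :=
  ∀ T : M.elems, ρ * Metric.diam (T : Set (Pt d)) ^ d ≤ volume.real (T : Set (Pt d)) ∧
    (M.facesOf T).card ≤ N

/-- The diameters of the elements are comparable: `h ≤ γ h_T` for all `T`. -/
def IsQuasiUniform (γ : ℝ) : Prop :=
  ∀ T : M.elems, M.meshSize ≤ γ * Metric.diam (T : Set (Pt d))

/-- The ambient space of pairs `v = {v₀, v_b}`: a polynomial vector field on each element (elements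
have nonempty interior, so a polynomial function on an element is given by a unique polynomial) and
a vector field on each face (single-valued, as faces are shared by the adjacent elements). -/
abbrev WeakField : Type :=
  (M.elems → Fin d → MvPolynomial (Fin d) ℝ) × (M.faces → Pt d → Pt d)

/-- The weak Galerkin space `V_h`: `v₀|_T ∈ [P_k(T)]^d` and `v_b|_e ∈ V_{k-1}(e)`. -/
def Vh (k : ℕ) : Submodule ℝ M.WeakField where
  carrier := {v | (∀ T i, v.1 T i ∈ MvPolynomial.restrictTotalDegree (Fin d) ℝ k) ∧
    ∀ e : M.faces, v.2 e ∈ faceSpace k (e : Set (Pt d))}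
  add_mem' := fun hv hw => ⟨fun T i => Submodule.add_mem _ (hv.1 T i) (hw.1 T i),
    fun e => Submodule.add_mem _ (hv.2 e) (hw.2 e)⟩
  zero_mem' := ⟨fun _ _ => Submodule.zero_mem _, fun _ => Submodule.zero_mem _⟩
  smul_mem' := fun c _ hv => ⟨fun T i => Submodule.smul_mem _ c (hv.1 T i),
    fun e => Submodule.smul_mem _ c (hv.2 e)⟩

/-- The subspace `V_h⁰` of the `v ∈ V_h` with `v_b = 0` on `∂Ω`. -/
def Vh0 (k : ℕ) : Submodule ℝ M.WeakField where
  carrier := {v | v ∈ M.Vh k ∧ ∀ e : M.faces, (e : Set (Pt d)) ⊆ frontier Ω → v.2 e = 0}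
  add_mem' := fun {v w} hv hw => ⟨Submodule.add_mem _ hv.1 hw.1,
    fun e he => by
      change v.2 e + w.2 e = 0
      rw [hv.2 e he, hw.2 e he, add_zero]⟩
  zero_mem' := ⟨Submodule.zero_mem _, fun _ _ => rfl⟩
  smul_mem' := fun c v hv => ⟨Submodule.smul_mem _ c hv.1, fun e he => by
    change c • v.2 e = 0
    rw [hv.2 e he, smul_zero]⟩

/-- The space `W_h` of piecewise polynomials of degree at most `k - 1`. -/
def Wh (k : ℕ) : Submodule ℝ (M.elems → MvPolynomial (Fin d) ℝ) :=
  Submodule.pi Set.univ fun _ => MvPolynomial.restrictTotalDegree (Fin d) ℝ (k - 1)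

/-- `W_h⁰ = W_h ∩ L²₀(Ω)`, the elements of `W_h` of mean value zero. -/
def Wh0 (k : ℕ) : Set (M.elems → MvPolynomial (Fin d) ℝ) :=
  {q | q ∈ M.Wh k ∧ ∑ T : M.elems, ∫ x in (T : Set (Pt d)), evalPoly (q T) x = 0}

/-- `p` is the discrete weak divergence `∇_{w,r,T} · v` of `v = {v₀, v_b}`: `p ∈ P_r(T)` and
`(p, φ)_T = -(v₀, ∇ φ)_T + ⟨v_b · n, φ⟩_{∂T}` for all `φ ∈ P_r(T)`. -/
def IsWeakDiv (r : ℕ) (T : M.elems) (v₀ : Pt d → Pt d) (vb : M.faces → Pt d → Pt d)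
    (p : MvPolynomial (Fin d) ℝ) : Prop :=
  p ∈ MvPolynomial.restrictTotalDegree (Fin d) ℝ r ∧
  ∀ φ ∈ MvPolynomial.restrictTotalDegree (Fin d) ℝ r,
    ∫ x in (T : Set (Pt d)), evalPoly p x * evalPoly φ x =
      -(∫ x in (T : Set (Pt d)), inner ℝ (v₀ x) (gradPoly φ x)) +
      ∑ e ∈ M.facesOf T, faceIntegral (e : Set (Pt d))
        (fun x => inner ℝ (vb e x) (outwardNormal (T : Set (Pt d)) e) * evalPoly φ x)

open scoped Classical in
/-- The discrete weak divergence `∇_{w,r,T} · v`. -/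
def weakDiv (r : ℕ) (T : M.elems) (v₀ : Pt d → Pt d) (vb : M.faces → Pt d → Pt d) :
    MvPolynomial (Fin d) ℝ :=
  if h : ∃ p, M.IsWeakDiv r T v₀ vb p then h.choose else 0

/-- `b(v, q) = ∑_T (∇_w · v, q)_T`, with the discrete weak divergence of degree `k - 1`. -/
def bForm (k : ℕ) (v : M.WeakField) (q : M.elems → MvPolynomial (Fin d) ℝ) : ℝ :=
  ∑ T : M.elems, ∫ x in (T : Set (Pt d)),
    evalPoly (M.weakDiv (k - 1) T (evalVec (v.1 T)) v.2) x * evalPoly (q T) x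

/-- The norm `|||v||| = (∑_T ‖ε(v₀)‖_T² + h_T⁻¹ ‖Q_b v₀ - v_b‖_{∂T}²)^{1/2}`. -/
def normV (k : ℕ) (v : M.WeakField) : ℝ :=
  Real.sqrt (∑ T : M.elems,
    ((∫ x in (T : Set (Pt d)), ∑ i, ∑ j, strain (v.1 T) x i j ^ 2) +
      (Metric.diam (T : Set (Pt d)))⁻¹ * ∑ e ∈ M.facesOf T, faceIntegral (e : Set (Pt d))
        (fun x => ‖faceProj k (e : Set (Pt d)) (evalVec (v.1 T)) x - v.2 e x‖ ^ 2)))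

/-- The jump of `q` across `e` as a vector, `q|_{T₁} n₁ + q|_{T₂} n₂ = (q|_{T₁} - q|_{T₂}) n₁` on
a face shared by `T₁` and `T₂` with outward normals `n₁ = -n₂`; its length is `|q|_{T₁} - q|_{T₂}|`,
whichever of the two elements comes first. -/
def jump (q : M.elems → MvPolynomial (Fin d) ℝ) (e : M.faces) (x : Pt d) : Pt d :=
  ∑ T ∈ M.elemsOf e, evalPoly (q T) x • outwardNormal (T : Set (Pt d)) e

/-- The norm `|||q|||₀ = (h ∑_{e ∈ ℰ_h⁰} ‖[q]_e‖_e² + h² ∑_T ‖∇ q‖_T²)^{1/2}`. -/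
def normW (q : M.elems → MvPolynomial (Fin d) ℝ) : ℝ :=
  Real.sqrt
    (M.meshSize * ∑ e ∈ M.interiorFaces, faceIntegral (e : Set (Pt d)) (fun x => ‖M.jump q e x‖ ^ 2)
      + M.meshSize ^ 2 * ∑ T : M.elems, ∫ x in (T : Set (Pt d)), ‖gradPoly (q T) x‖ ^ 2)

end PolyMesh

end WGElasticity

end

noncomputable section

namespace WGElasticity

/-! The supremum is bounded below by one explicit test field: `v₀ = -h² ∇q` on elements, `v_b = h
[[q]]` on interior faces, zero on boundary faces. The definition of the weak divergence, with the
face terms regrouped face by face, gives `b(v, q) = |||q|||₀²` exactly (`bForm_testField`). What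
remains is `|||v||| ≤ K |||q|||₀` with `K` depending only on the data (`exists_normV_testField_le`).

That estimate needs inverse and trace inequalities on elements that are not assumed convex or
star-shaped. They come from `|T| ≥ ρ h_T^d` alone. By compactness, on polynomials of bounded degree
the `L²` norm over any subset of the unit ball of measure at least `ρ` controls all coefficients
(`exists_coeff_le_setIntegral`). After rescaling, `T` is such a subset of a ball of radius `h_T`, so
`p` and `h_T ∇p` are bounded pointwise on `T`. Integrating over `T`, or over a flat face of measure
at most a constant times `h_T^(d-1)`, gives both inequalities (`exists_inverse_trace_bound`).
Quasi-uniformity exchanges `h` for `h_T`, and each face is shared by at most two elements.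

The definiteness of `|||·|||` on `V_h⁰` is never needed: if the test field has norm zero, a small
perturbation of it replaces it (`exists_quotient_ge`). -/

/-! ### Zero sets of polynomials and a Remez-type bound by compactness. -/

theorem continuous_evalPoly {d : ℕ} (p : MvPolynomial (Fin d) ℝ) : Continuous (evalPoly p) :=
  (MvPolynomial.continuous_eval p).comp (by fun_prop)

/-- A measurable set that meets each line through the origin in a null set of parameters is itself
null. -/
theorem volume_eq_zero_of_forall_line {d : ℕ} {Z : Set (Pt d)} (hZ : MeasurableSet Z)
    (h : ∀ x : Pt d, volume {t : ℝ | t • x ∈ Z} = 0) : volume Z = 0 := by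
  have hm : MeasurableSet {x : Pt d × ℝ | ¬ (x.2 • x.1 ∈ Z)} := by
    have : Measurable fun x : Pt d × ℝ => x.2 • x.1 := by fun_prop
    exact (this hZ).compl
  have h1 : ∀ᵐ x : Pt d, ∀ᵐ t : ℝ, ¬ (t • x ∈ Z) := by
    refine Eventually.of_forall fun x => ?_
    rw [ae_iff]
    simpa using h x
  -- Fubini: almost every dilate of `Z` is null. One nonzero factor `t` is enough, since dilation
  -- multiplies the volume by a nonzero constant.
  rw [Measure.ae_ae_comm hm] at h1
  have h2 : ∀ᵐ t : ℝ, t ≠ 0 := by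
    rw [ae_iff]
    simp
  obtain ⟨t, ht, ht0⟩ := (h1.and h2).exists
  rw [ae_iff] at ht
  have h3 : volume ((t • ·) ⁻¹' Z : Set (Pt d)) = 0 := by
    simpa [Set.preimage, not_not] using ht
  rw [Measure.addHaar_preimage_smul _ ht0] at h3
  refine (mul_eq_zero.1 h3).resolve_left ?_
  simp [ht0]

/-- The zero set of a nonzero polynomial is a null set. -/
theorem volume_zeros_eq_zero {d : ℕ} {p : MvPolynomial (Fin d) ℝ} (hp : p ≠ 0) :
    volume {x : Pt d | evalPoly p x = 0} = 0 := by
  obtain ⟨a, ha⟩ : ∃ a : Fin d → ℝ, MvPolynomial.eval a p ≠ 0 := by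
    by_contra! h
    exact hp (MvPolynomial.funext fun x => by simpa using h x)
  set x₀ : Pt d := WithLp.toLp 2 a
  have hmeas : MeasurableSet {x : Pt d | evalPoly p x = 0} :=
    (isClosed_singleton.preimage (continuous_evalPoly p)).measurableSet
  have key : volume ((fun x => x₀ + x) ⁻¹' {x : Pt d | evalPoly p x = 0}) = 0 := by
    refine volume_eq_zero_of_forall_line (hmeas.preimage (by fun_prop)) fun x => ?_
    -- The restriction of `p` to a line through `x₀`. It is a nonzero univariate polynomial because
    -- its value at `0` is `p(x₀) ≠ 0`, so it has finitely many roots.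
    set g : Polynomial ℝ := MvPolynomial.aeval
      (fun i => Polynomial.C (a i) + Polynomial.X * Polynomial.C (x i)) p with hg
    have heval : ∀ t : ℝ, g.eval t = evalPoly p (x₀ + t • x) := by
      intro t
      rw [hg, ← Polynomial.coe_aeval_eq_eval, ← AlgHom.comp_apply, MvPolynomial.comp_aeval,
        MvPolynomial.aeval_eq_eval, evalPoly]
      congr 2
      funext i
      simp [x₀, mul_comm (x i) t]
    have hg0 : g ≠ 0 := by
      intro h0
      have h1 := heval 0
      rw [h0, Polynomial.eval_zero, zero_smul, add_zero] at h1
      exact ha h1.symm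
    refine Set.Finite.measure_zero ((Polynomial.finite_setOfPred_isRoot hg0).subset ?_) _
    intro t ht
    simp only [Set.mem_preimage, Set.mem_ofPred_eq] at ht
    rw [Set.mem_ofPred_eq, Polynomial.IsRoot, heval, ht]
  rwa [measure_preimage_add] at key

/-- Continuity of the measure from above: the sets `{|g| ≤ 1/(n+1)}` inside `K` decrease to the zero
set of `g`, which is null. -/
theorem exists_small_sublevel {E : Type*} [TopologicalSpace E] [MeasurableSpace E]
    [OpensMeasurableSpace E] [T2Space E] {μ : Measure E} [IsFiniteMeasureOnCompacts μ] {K : Set E}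
    (hK : IsCompact K) {g : E → ℝ} (hg : Continuous g) (h0 : μ {x | g x = 0} = 0) {δ : ℝ}
    (hδ : 0 < δ) : ∃ ε > 0, μ.real (K ∩ {x | |g x| ≤ ε}) < δ := by
  have hmeas : ∀ ε : ℝ, MeasurableSet (K ∩ {x | |g x| ≤ ε}) := fun ε =>
    hK.measurableSet.inter (isClosed_le (by fun_prop) continuous_const).measurableSet
  have hlim : Tendsto (fun n : ℕ => μ (K ∩ {x | |g x| ≤ 1 / ((n : ℝ) + 1)})) atTop
      (𝓝 (μ (⋂ n : ℕ, K ∩ {x | |g x| ≤ 1 / ((n : ℝ) + 1)}))) := by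
    refine tendsto_measure_iInter_atTop (fun n => (hmeas _).nullMeasurableSet) ?_ ⟨0, ?_⟩
    · intro m n hmn
      refine Set.inter_subset_inter_right _ fun x (hx : |g x| ≤ _) => hx.trans ?_
      exact Nat.one_div_le_one_div hmn
    · exact ((measure_mono Set.inter_subset_left).trans_lt hK.measure_lt_top).ne
  have hz : μ (⋂ n : ℕ, K ∩ {x | |g x| ≤ 1 / ((n : ℝ) + 1)}) = 0 := by
    refine measure_mono_null (fun x hx => ?_) h0
    rw [Set.mem_iInter] at hx
    have : |g x| ≤ 0 := ge_of_tendsto' tendsto_one_div_add_atTop_nhds_zero_nat fun n => (hx n).2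
    simpa using this
  rw [hz] at hlim
  obtain ⟨n, hn⟩ := (hlim.eventually_lt_const (ENNReal.ofReal_pos.2 hδ)).exists
  exact ⟨1 / ((n : ℝ) + 1), by positivity, ENNReal.toReal_lt_of_lt_ofReal hn⟩

/-- A compactness form of the Remez inequality: in a finite-dimensional space of continuous
functions with null zero sets, the `L²` norm over any subset of `K` of measure at least `δ`
controls the coefficients. -/
theorem exists_coeff_le_setIntegral {ι E : Type*} [Fintype ι] [TopologicalSpace E]
    [MeasurableSpace E] [BorelSpace E] [T2Space E] {μ : Measure E}
    [IsFiniteMeasureOnCompacts μ] {K : Set E} (hK : IsCompact K) {φ : ι → E → ℝ}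
    (hφ : ∀ i, Continuous (φ i)) (h0 : ∀ c : ι → ℝ, c ≠ 0 → μ {x | ∑ i, c i * φ i x = 0} = 0)
    {δ : ℝ} (hδ : 0 < δ) :
    ∃ κ > 0, ∀ c : ι → ℝ, ∀ A ⊆ K, MeasurableSet A → δ ≤ μ.real A →
      κ * ‖c‖ ^ 2 ≤ ∫ x in A, (∑ i, c i * φ i x) ^ 2 ∂μ := by
  choose B hB using fun i => hK.exists_bound_of_continuousOn (hφ i).continuousOn
  set S : ℝ := ∑ i, |B i| with hS
  have hS0 : 0 ≤ S := Finset.sum_nonneg fun i _ => abs_nonneg _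
  have hbound : ∀ c : ι → ℝ, ∀ x ∈ K, |∑ i, c i * φ i x| ≤ ‖c‖ * S := by
    intro c x hx
    refine (Finset.abs_sum_le_sum_abs _ _).trans ?_
    rw [hS, Finset.mul_sum]
    refine Finset.sum_le_sum fun i _ => ?_
    rw [abs_mul]
    exact mul_le_mul (norm_le_pi_norm c i) ((hB i x hx).trans (le_abs_self _)) (abs_nonneg _)
      (norm_nonneg _)
  have hcont : ∀ c : ι → ℝ, Continuous fun x => ∑ i, c i * φ i x := fun c => by fun_prop
  have hint : ∀ c : ι → ℝ, IntegrableOn (fun x => (∑ i, c i * φ i x) ^ 2) K μ := fun c =>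
    ((hcont c).pow 2).continuousOn.integrableOn_compact hK
  obtain ⟨κ, hκ, hκ'⟩ : ∃ κ > 0, ∀ c ∈ Metric.sphere (0 : ι → ℝ) 1, ∀ A ⊆ K, MeasurableSet A →
      δ ≤ μ.real A → κ ≤ ∫ x in A, (∑ i, c i * φ i x) ^ 2 ∂μ := by
    -- Having a uniform lower bound is stable under subsets and finite unions, so on the compact
    -- sphere it need only be checked near each `c₀`.
    refine (isCompact_sphere (0 : ι → ℝ) 1).induction_on (p := fun s => ∃ κ > 0, ∀ c ∈ s, ∀ A ⊆ K,
      MeasurableSet A → δ ≤ μ.real A → κ ≤ ∫ x in A, (∑ i, c i * φ i x) ^ 2 ∂μ)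
      ⟨1, one_pos, by simp⟩ ?_ ?_ ?_
    · rintro s t hst ⟨κ, h, h'⟩
      exact ⟨κ, h, fun c hc => h' c (hst hc)⟩
    · rintro s t ⟨κ, h, h'⟩ ⟨κ', h1, h1'⟩
      refine ⟨min κ κ', lt_min h h1, fun c hc A hA hm hd => ?_⟩
      rcases hc with hc | hc
      · exact (min_le_left _ _).trans (h' c hc A hA hm hd)
      · exact (min_le_right _ _).trans (h1' c hc A hA hm hd)
    · intro c₀ hc₀
      have hne : c₀ ≠ 0 := by
        rintro rfl
        simp at hc₀
      obtain ⟨ε, hε, hlt⟩ := exists_small_sublevel hK (hcont c₀) (h0 c₀ hne) (half_pos hδ)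
      -- With this radius the combinations for `c` and `c₀` differ by at most `ε / 2` on `K`. Off
      -- the sublevel set `U`, of measure below `δ / 2`, the one for `c₀` exceeds `ε`; hence the one
      -- for `c` is at least `ε / 2` on a part of `A` of measure at least `δ / 2`.
      refine ⟨Metric.ball c₀ (ε / (2 * (S + 1))), mem_nhdsWithin_of_mem_nhds
        (Metric.ball_mem_nhds _ (by positivity)), (ε / 2) ^ 2 * (δ / 2), by positivity, ?_⟩
      intro c hc A hA hm hd
      set U := K ∩ {x | |∑ i, c₀ i * φ i x| ≤ ε} with hU
      have hUm : MeasurableSet U := hK.measurableSet.inter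
        (isClosed_le (hcont c₀).abs continuous_const).measurableSet
      have hfin : ∀ s ⊆ K, μ s ≠ ⊤ := fun s hs =>
        ((measure_mono hs).trans_lt hK.measure_lt_top).ne
      have h1 : δ / 2 ≤ μ.real (A \ U) := by
        have h2 : μ.real A ≤ μ.real (A \ U) + μ.real U := by
          refine (measureReal_mono (s₂ := A \ U ∪ U) (fun x hx => ?_) ?_).trans
            (measureReal_union_le _ _)
          · exact (em (x ∈ U)).elim Or.inr fun h => Or.inl ⟨hx, h⟩
          exact hfin _ (Set.union_subset (Set.sdiff_subset.trans hA) Set.inter_subset_left)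
        linarith
      have h3 : ∀ x ∈ A \ U, (ε / 2) ^ 2 ≤ (∑ i, c i * φ i x) ^ 2 := by
        rintro x ⟨hxA, hxU⟩
        have h4 : ε < |∑ i, c₀ i * φ i x| := by
          by_contra! h
          exact hxU ⟨hA hxA, h⟩
        have h5 := hbound (c₀ - c) x (hA hxA)
        have h6 : ‖c₀ - c‖ * S ≤ ε / 2 := by
          rw [Metric.mem_ball, dist_comm, dist_eq_norm, lt_div_iff₀ (by positivity)] at hc
          nlinarith [norm_nonneg (c₀ - c)]
        have h7 : ∑ i, (c₀ - c) i * φ i x = ∑ i, c₀ i * φ i x - ∑ i, c i * φ i x := by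
          simp [sub_mul]
        rw [h7] at h5
        rw [← sq_abs (∑ i, c i * φ i x)]
        have h8 := abs_sub_abs_le_abs_sub (∑ i, c₀ i * φ i x) (∑ i, c i * φ i x)
        exact pow_le_pow_left₀ (by positivity) (by linarith) 2
      calc (ε / 2) ^ 2 * (δ / 2) ≤ (ε / 2) ^ 2 * μ.real (A \ U) := by gcongr
        _ ≤ ∫ x in A \ U, (∑ i, c i * φ i x) ^ 2 ∂μ :=
          setIntegral_ge_of_const_le_real (hm.diff hUm) (hfin _ (Set.sdiff_subset.trans hA)) h3
            ((hint c).mono_set (Set.sdiff_subset.trans hA))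
        _ ≤ ∫ x in A, (∑ i, c i * φ i x) ^ 2 ∂μ :=
          setIntegral_mono_set ((hint c).mono_set hA) (Eventually.of_forall fun x => sq_nonneg _)
            (Eventually.of_forall Set.sdiff_subset)
  refine ⟨κ, hκ, fun c A hA hm hd => ?_⟩
  rcases eq_or_ne c 0 with rfl | hc
  · simp
  have hc' : ‖c‖ ≠ 0 := norm_ne_zero_iff.2 hc
  -- Both sides are homogeneous of degree two in `c`, so the bound on the unit sphere suffices.
  have h1 := hκ' (‖c‖⁻¹ • c) (by simp [norm_smul, hc']) A hA hm hd
  have h2 : ∀ x, (∑ i, (‖c‖⁻¹ • c) i * φ i x) ^ 2 = (‖c‖ ^ 2)⁻¹ * (∑ i, c i * φ i x) ^ 2 := by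
    intro x
    simp only [Pi.smul_apply, smul_eq_mul, mul_assoc, ← Finset.mul_sum, mul_pow, inv_pow]
  simp only [h2, integral_const_mul] at h1
  rwa [inv_mul_eq_div, le_div_iff₀ (by positivity)] at h1

/-! ### Polynomials under affine rescaling, and scaled pointwise bounds. -/

theorem evalPoly_add {d : ℕ} (p q : MvPolynomial (Fin d) ℝ) (x : Pt d) :
    evalPoly (p + q) x = evalPoly p x + evalPoly q x := map_add _ _ _

theorem evalPoly_smul {d : ℕ} (c : ℝ) (p : MvPolynomial (Fin d) ℝ) (x : Pt d) :
    evalPoly (c • p) x = c * evalPoly p x := MvPolynomial.smul_eval _ _ _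

theorem evalPoly_sum {d : ℕ} {ι : Type*} (s : Finset ι) (p : ι → MvPolynomial (Fin d) ℝ)
    (x : Pt d) : evalPoly (∑ i ∈ s, p i) x = ∑ i ∈ s, evalPoly (p i) x := map_sum _ _ _

theorem pderiv_mem_restrictTotalDegree {d m : ℕ} {p : MvPolynomial (Fin d) ℝ}
    (hp : p ∈ MvPolynomial.restrictTotalDegree (Fin d) ℝ m) (i : Fin d) :
    MvPolynomial.pderiv i p ∈ MvPolynomial.restrictTotalDegree (Fin d) ℝ m := by
  rw [MvPolynomial.mem_restrictTotalDegree] at hp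
  rw [← p.support_sum_monomial_coeff, map_sum]
  refine Submodule.sum_mem _ fun s hs => ?_
  rw [MvPolynomial.pderiv_monomial, MvPolynomial.mem_restrictTotalDegree]
  refine (MvPolynomial.totalDegree_monomial_le _ _).trans ?_
  refine le_trans ?_ ((MvPolynomial.le_totalDegree hs).trans hp)
  rw [Finsupp.sum_fintype _ _ fun _ => rfl, Finsupp.sum_fintype _ _ fun _ => rfl]
  exact Finset.sum_le_sum fun j _ => Nat.sub_le _ _

/-- The polynomial `y ↦ p (x₀ + h y)`. -/
def rescale {d : ℕ} (x₀ : Pt d) (h : ℝ) :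
    MvPolynomial (Fin d) ℝ →ₐ[ℝ] MvPolynomial (Fin d) ℝ :=
  MvPolynomial.aeval fun i => MvPolynomial.C (x₀ i) + MvPolynomial.C h * MvPolynomial.X i

theorem evalPoly_rescale {d : ℕ} (x₀ : Pt d) (h : ℝ) (p : MvPolynomial (Fin d) ℝ) (y : Pt d) :
    evalPoly (rescale x₀ h p) y = evalPoly p (x₀ + h • y) := by
  rw [evalPoly, ← MvPolynomial.aeval_eq_eval, rescale, ← AlgHom.comp_apply,
    MvPolynomial.comp_aeval, MvPolynomial.aeval_eq_eval, evalPoly]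
  congr 2
  funext i
  simp

/-- The chain rule; it is the source of the factor `h ^ 2` in front of squared derivatives in the
scaled bound. -/
theorem pderiv_rescale {d : ℕ} (x₀ : Pt d) (h : ℝ) (p : MvPolynomial (Fin d) ℝ) (i : Fin d) :
    MvPolynomial.pderiv i (rescale x₀ h p) = h • rescale x₀ h (MvPolynomial.pderiv i p) := by
  induction p using MvPolynomial.induction_on with
  | C a => simp [rescale, MvPolynomial.algebraMap_eq]
  | add p q hp hq => simp [hp, hq]
  | mul_X p j hp =>
    rw [map_mul, Derivation.leibniz, hp, Derivation.leibniz, map_add, smul_eq_mul, smul_eq_mul,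
      smul_eq_mul, smul_eq_mul, map_mul, map_mul]
    have h1 : MvPolynomial.pderiv i (rescale x₀ h (MvPolynomial.X j))
        = h • rescale x₀ h (MvPolynomial.pderiv i (MvPolynomial.X j)) := by
      rcases eq_or_ne j i with rfl | hij
      · simp [rescale, MvPolynomial.smul_eq_C_mul]
      · simp [rescale, MvPolynomial.pderiv_X_of_ne hij]
    rw [h1, smul_add, mul_smul_comm, mul_smul_comm]

theorem rescale_mem_restrictTotalDegree {d m : ℕ} (x₀ : Pt d) (h : ℝ)
    {p : MvPolynomial (Fin d) ℝ} (hp : p ∈ MvPolynomial.restrictTotalDegree (Fin d) ℝ m) :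
    rescale x₀ h p ∈ MvPolynomial.restrictTotalDegree (Fin d) ℝ m := by
  rw [MvPolynomial.mem_restrictTotalDegree] at hp
  rw [rescale, MvPolynomial.aeval_def, MvPolynomial.eval₂_eq]
  refine Submodule.sum_mem _ fun s hs => ?_
  rw [MvPolynomial.algebraMap_eq, ← MvPolynomial.smul_eq_C_mul]
  refine Submodule.smul_mem _ _ ?_
  rw [MvPolynomial.mem_restrictTotalDegree]
  refine (MvPolynomial.totalDegree_finsetProd _ _).trans ?_
  refine le_trans (Finset.sum_le_sum fun i _ => ?_) ((MvPolynomial.le_totalDegree hs).trans hp)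
  refine (MvPolynomial.totalDegree_pow _ _).trans ?_
  refine (Nat.mul_le_mul_left _ (?_ : _ ≤ 1)).trans_eq (mul_one _)
  refine (MvPolynomial.totalDegree_add _ _).trans (max_le (by simp) ?_)
  refine (MvPolynomial.totalDegree_mul _ _).trans (by simp)

/-- A polynomial and its derivatives are bounded on the unit ball by the `L²` norm over any subset
whose measure is bounded below. -/
theorem exists_sq_le_setIntegral_unitBall (d m : ℕ) {ρ : ℝ} (hρ : 0 < ρ) :
    ∃ C > 0, ∀ p ∈ MvPolynomial.restrictTotalDegree (Fin d) ℝ m,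
      ∀ A ⊆ Metric.closedBall (0 : Pt d) 1, MeasurableSet A → ρ ≤ volume.real A →
      ∀ y ∈ Metric.closedBall (0 : Pt d) 1,
        evalPoly p y ^ 2 ≤ C * ∫ x in A, evalPoly p x ^ 2 ∧
        ∀ i, evalPoly (MvPolynomial.pderiv i p) y ^ 2 ≤ C * ∫ x in A, evalPoly p x ^ 2 := by
  set b := Module.finBasis ℝ (MvPolynomial.restrictTotalDegree (Fin d) ℝ m) with hb
  have hK := isCompact_closedBall (0 : Pt d) 1
  have hsum : ∀ (c : Fin _ → ℝ) (x : Pt d), evalPoly (∑ j, c j • (b j : MvPolynomial (Fin d) ℝ)) x =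
      ∑ j, c j * evalPoly (b j : MvPolynomial (Fin d) ℝ) x := by
    intro c x
    simp only [evalPoly_sum, evalPoly_smul]
  obtain ⟨κ, hκ, hκ'⟩ := exists_coeff_le_setIntegral (μ := volume) hK
    (φ := fun j => evalPoly (b j : MvPolynomial (Fin d) ℝ)) (fun j => continuous_evalPoly _)
    (by
      intro c hc
      simp only [← hsum]
      refine volume_zeros_eq_zero fun h => hc ?_
      have h1 : ∑ j, c j • b j = 0 := by
        apply Subtype.ext
        simpa using h
      funext j
      exact Fintype.linearIndependent_iff.1 b.linearIndependent c h1 j) hρ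
  -- Stated for any linear operator `L`, so that the identity and every partial derivative are
  -- covered at once.
  have hB : ∀ L : MvPolynomial (Fin d) ℝ →ₗ[ℝ] MvPolynomial (Fin d) ℝ, ∃ S, 0 ≤ S ∧
      ∀ c : Fin _ → ℝ, ∀ y ∈ Metric.closedBall (0 : Pt d) 1,
        evalPoly (L (∑ j, c j • (b j : MvPolynomial (Fin d) ℝ))) y ^ 2 ≤ S * ‖c‖ ^ 2 := by
    intro L
    choose B hB using fun j => hK.exists_bound_of_continuousOn
      (continuous_evalPoly (L (b j : MvPolynomial (Fin d) ℝ))).continuousOn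
    refine ⟨(∑ j, |B j|) ^ 2, sq_nonneg _, fun c y hy => ?_⟩
    rw [← mul_pow, ← sq_abs]
    refine pow_le_pow_left₀ (abs_nonneg _) ?_ 2
    simp only [map_sum, map_smul, evalPoly_sum, evalPoly_smul]
    refine (Finset.abs_sum_le_sum_abs _ _).trans ?_
    rw [Finset.sum_mul]
    refine Finset.sum_le_sum fun j _ => ?_
    rw [abs_mul, mul_comm]
    exact mul_le_mul ((hB j y hy).trans (le_abs_self _)) (norm_le_pi_norm c j) (abs_nonneg _)
      (abs_nonneg _)
  obtain ⟨S, hS, hS'⟩ := hB LinearMap.id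
  choose D hD hD' using fun i : Fin d => hB (MvPolynomial.pderiv i).toLinearMap
  have hDs : ∀ i, D i ≤ ∑ i, D i := fun i =>
    Finset.single_le_sum (fun j _ => hD j) (Finset.mem_univ i)
  have hD0 : 0 ≤ ∑ i, D i := Finset.sum_nonneg fun i _ => hD i
  refine ⟨(S + ∑ i, D i + 1) / κ, by positivity, fun p hp A hA hm hr y hy => ?_⟩
  obtain ⟨c, rfl⟩ : ∃ c : Fin _ → ℝ, p = ∑ j, c j • (b j : MvPolynomial (Fin d) ℝ) := by
    exact ⟨b.repr ⟨p, hp⟩, (congrArg Subtype.val (b.sum_repr ⟨p, hp⟩)).symm.trans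
      (by rw [Submodule.coe_sum]; rfl)⟩
  have h1 := hκ' c A hA hm hr
  simp only [← hsum] at h1
  have h2 : ∀ s, s ≤ S + ∑ i, D i + 1 → s * ‖c‖ ^ 2 ≤ (S + ∑ i, D i + 1) / κ *
      ∫ x in A, evalPoly (∑ j, c j • (b j : MvPolynomial (Fin d) ℝ)) x ^ 2 := by
    intro s hs
    rw [div_mul_eq_mul_div, le_div_iff₀ hκ, mul_assoc, mul_comm _ κ]
    exact mul_le_mul hs h1 (by positivity) (by positivity)
  exact ⟨(hS' c y hy).trans (h2 _ (by linarith)),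
    fun i => (hD' i c y hy).trans (h2 _ (by linarith [hDs i]))⟩

/-- The scaled form of the previous bound: on a ball of radius `h`, the sup norms of `p` and
`h ∇ p` are controlled by the `L²` norm over a subset of measure at least `ρ h ^ d`. -/
theorem exists_sq_le_setIntegral (d m : ℕ) {ρ : ℝ} (hρ : 0 < ρ) :
    ∃ C > 0, ∀ p ∈ MvPolynomial.restrictTotalDegree (Fin d) ℝ m, ∀ (x₀ : Pt d) (h : ℝ), 0 < h →
      ∀ A ⊆ Metric.closedBall x₀ h, MeasurableSet A → ρ * h ^ d ≤ volume.real A →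
      ∀ x ∈ Metric.closedBall x₀ h,
        h ^ d * evalPoly p x ^ 2 ≤ C * ∫ x in A, evalPoly p x ^ 2 ∧
        ∀ i, h ^ d * (h ^ 2 * evalPoly (MvPolynomial.pderiv i p) x ^ 2) ≤
          C * ∫ x in A, evalPoly p x ^ 2 := by
  obtain ⟨C, hC, hC'⟩ := exists_sq_le_setIntegral_unitBall d m hρ
  refine ⟨C, hC, fun p hp x₀ h hh A hA hm hr x hx => ?_⟩
  have hd0 : 0 < h ^ d := pow_pos hh d
  set ψ : Pt d → Pt d := fun y => x₀ + h • y with hψ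
  have hψm : Measurable ψ := by fun_prop
  have hball : ∀ y, ψ y ∈ Metric.closedBall x₀ h → y ∈ Metric.closedBall (0 : Pt d) 1 := by
    intro y hy
    rw [mem_closedBall_iff_norm, hψ, add_sub_cancel_left, norm_smul, Real.norm_of_nonneg hh.le] at hy
    rw [mem_closedBall_zero_iff]
    exact le_of_mul_le_mul_left (by linarith) hh
  have hint : ∀ f : Pt d → ℝ, h ^ d * ∫ y, f (ψ y) = ∫ x, f x := by
    intro f
    have h1 := Measure.integral_comp_smul volume (fun z : Pt d => f (x₀ + z)) h
    rw [integral_add_left_eq_self f x₀] at h1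
    rw [hψ, h1, abs_of_pos (by positivity), finrank_euclideanSpace_fin, smul_eq_mul,
      mul_inv_cancel_left₀ hd0.ne']
  have hset : ∀ f : Pt d → ℝ, h ^ d * ∫ y in ψ ⁻¹' A, f (ψ y) = ∫ x in A, f x := by
    intro f
    rw [← integral_indicator hm, ← integral_indicator (hψm hm), ← hint (A.indicator f)]
    rfl
  have hvol : h ^ d * volume.real (ψ ⁻¹' A) = volume.real A := by
    have := hset fun _ => 1
    simpa using this
  obtain ⟨y, rfl⟩ : ∃ y, ψ y = x := ⟨h⁻¹ • (x - x₀), by simp [hψ, smul_smul, hh.ne']⟩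
  have h2 := hC' (rescale x₀ h p) (rescale_mem_restrictTotalDegree x₀ h hp) (ψ ⁻¹' A)
    (fun y hy => hball y (hA hy)) (hψm hm)
    (le_of_mul_le_mul_left (by rw [hvol]; linarith) hd0) y (hball y hx)
  simp only [pderiv_rescale, evalPoly_smul, evalPoly_rescale, mul_pow] at h2
  rw [← hset fun x => evalPoly p x ^ 2, mul_left_comm]
  exact ⟨mul_le_mul_of_nonneg_left h2.1 hd0.le,
    fun i => mul_le_mul_of_nonneg_left (h2.2 i) hd0.le⟩

/-! ### Volume, diameter and face measure of polytopes. -/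

namespace IsPolytope

variable {d n : ℕ} {P : Set (Pt d)}

theorem isCompact (hP : IsPolytope n P) : IsCompact P := by
  obtain ⟨S, rfl⟩ := hP.finite_union
  exact S.isCompact_biUnion fun s _ => s.finite_toSet.isCompact_convexHull ℝ

theorem nonempty (hP : IsPolytope n P) : P.Nonempty :=
  hP.connected.nonempty.mono intrinsicInterior_subset

/-- In full dimension the affine span is the whole space, so the relative interior is open in the
space and lies in the interior. -/
theorem interior_nonempty (hP : IsPolytope d P) : (interior P).Nonempty := by
  have hdir : (affineSpan ℝ P).direction = ⊤ :=
    Submodule.eq_top_of_finrank_eq (by rw [hP.dim_eq, finrank_euclideanSpace_fin])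
  have htop : affineSpan ℝ P = ⊤ :=
    (AffineSubspace.direction_eq_top_iff_of_nonempty (hP.nonempty.affineSpan ℝ)).1 hdir
  have hopen : IsOpen ((affineSpan ℝ P : AffineSubspace ℝ (Pt d)) : Set (Pt d)) := by
    rw [htop]
    exact isOpen_univ
  refine hP.connected.nonempty.mono (interior_maximal intrinsicInterior_subset ?_)
  exact hopen.isOpenEmbedding_subtypeVal.isOpenMap _ isOpen_interior

theorem volume_pos (hP : IsPolytope d P) : 0 < volume P :=
  Measure.measure_pos_of_nonempty_interior _ hP.interior_nonempty

theorem diam_pos (hd : 0 < d) (hP : IsPolytope d P) : 0 < Metric.diam P := by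
  refine Metric.diam_pos ?_ hP.isCompact.isBounded
  have : Nonempty (Fin d) := ⟨⟨0, hd⟩⟩
  have : Nontrivial (Pt d) := inferInstance
  by_contra h
  exact hP.volume_pos.ne' ((Set.not_nontrivial_iff.1 h).measure_zero _)

/-- The `n`-dimensional measure of a polytope of dimension `n` contained in a ball of radius `r`
centred at one of its points is at most that of the `n`-dimensional ball of radius `r`. -/
theorem euclideanHausdorffMeasure_le (hP : IsPolytope n P) {x₀ : Pt d} (hx₀ : x₀ ∈ P) {r : ℝ}
    (hr : 0 ≤ r) (hsub : P ⊆ Metric.closedBall x₀ r) :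
    (Measure.euclideanHausdorffMeasure n : Measure (Pt d)) P ≤
      ENNReal.ofReal (r ^ n) * volume (Metric.closedBall (0 : Pt n) 1) := by
  -- An orthonormal basis of the direction parametrizes the affine span isometrically by `Pt n`.
  -- Isometries preserve the Hausdorff measure, which on `Pt n` is the volume.
  set B := (stdOrthonormalBasis ℝ (affineSpan ℝ P).direction).reindex (finCongr hP.dim_eq)
  set i : Pt n → Pt d := fun y => x₀ + (B.repr.symm y : Pt d)
  have hi : Isometry i := by
    refine Isometry.of_dist_eq fun x y => ?_
    simp only [i, dist_add_left]
    rw [← Subtype.dist_eq, LinearIsometryEquiv.dist_map]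
  have hsub' : P ⊆ i '' Metric.closedBall 0 r := by
    intro x hx
    have hmem : x - x₀ ∈ (affineSpan ℝ P).direction :=
      AffineSubspace.vsub_mem_direction (subset_affineSpan ℝ P hx) (subset_affineSpan ℝ P hx₀)
    refine ⟨B.repr ⟨x - x₀, hmem⟩, ?_, by simp [i]⟩
    rw [mem_closedBall_zero_iff, LinearIsometryEquiv.norm_map]
    exact mem_closedBall_iff_norm.1 (hsub hx)
  refine (measure_mono hsub').trans ?_
  rw [hi.euclideanHausdorffMeasure_image, EuclideanSpace.euclideanHausdorffMeasure_eq_volume,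
    Measure.addHaar_closedBall' _ _ hr, finrank_euclideanSpace_fin]

theorem euclideanHausdorffMeasure_lt_top (hP : IsPolytope n P) :
    (Measure.euclideanHausdorffMeasure n : Measure (Pt d)) P < ⊤ := by
  obtain ⟨x₀, hx₀⟩ := hP.nonempty
  refine (hP.euclideanHausdorffMeasure_le hx₀ Metric.diam_nonneg fun x hx =>
    Metric.dist_le_diam_of_mem hP.isCompact.isBounded hx hx₀).trans_lt ?_
  exact ENNReal.mul_lt_top ENNReal.ofReal_lt_top (isCompact_closedBall _ _).measure_lt_top

theorem integrableOn_face (hP : IsPolytope n P) {F : Type*} [NormedAddCommGroup F]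
    {f : Pt d → F} (hf : ContinuousOn f P) :
    IntegrableOn f P (Measure.euclideanHausdorffMeasure n) := by
  obtain ⟨C, hC⟩ := hP.isCompact.exists_bound_of_continuousOn hf
  refine IntegrableOn.of_bound hP.euclideanHausdorffMeasure_lt_top
    (hf.aestronglyMeasurable_of_isCompact hP.isCompact hP.isCompact.measurableSet) C ?_
  exact ae_restrict_of_forall_mem hP.isCompact.measurableSet hC

end IsPolytope

/-! ### Normals and the incidence of faces and elements. -/

/-- Unit vectors orthogonal to a hyperplane agree up to sign. -/
theorem eq_or_eq_neg_of_orthogonal {d : ℕ} (hd : 0 < d) {W : Submodule ℝ (Pt d)}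
    (hW : Module.finrank ℝ W = d - 1) {u v : Pt d} (hu : ‖u‖ = 1) (hv : ‖v‖ = 1)
    (hu' : ∀ w ∈ W, inner ℝ u w = 0) (hv' : ∀ w ∈ W, inner ℝ v w = 0) : u = v ∨ u = -v := by
  have hfin : Module.finrank ℝ Wᗮ = 1 := by
    have := W.finrank_add_finrank_orthogonal
    rw [hW, finrank_euclideanSpace_fin] at this
    omega
  have huW : u ∈ Wᗮ := (Submodule.mem_orthogonal' _ _).2 hu'
  have hvW : v ∈ Wᗮ := (Submodule.mem_orthogonal' _ _).2 hv'
  have hv0 : (⟨v, hvW⟩ : Wᗮ) ≠ 0 := by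
    intro h
    have h0 : v = 0 := congrArg Subtype.val h
    simp [h0] at hv
  obtain ⟨c, hc⟩ := (finrank_eq_one_iff_of_nonzero' _ hv0).1 hfin ⟨u, huW⟩
  have hc' : c • v = u := congrArg Subtype.val hc
  have habs : |c| = 1 := by
    rw [← hc', norm_smul, hv, mul_one, Real.norm_eq_abs] at hu
    exact hu
  rcases eq_or_eq_neg_of_abs_eq habs with rfl | rfl
  · exact Or.inl (by rw [← hc', one_smul])
  · exact Or.inr (by rw [← hc', neg_one_smul])

namespace PolyMesh

variable {d : ℕ} {Ω : Set (Pt d)} (M : PolyMesh Ω)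

theorem mem_facesOf {T : M.elems} {e : M.faces} :
    e ∈ M.facesOf T ↔ (e : Set (Pt d)) ⊆ frontier (T : Set (Pt d)) := by
  simp [facesOf]

theorem mem_elemsOf {T : M.elems} {e : M.faces} :
    T ∈ M.elemsOf e ↔ (e : Set (Pt d)) ⊆ frontier (T : Set (Pt d)) := by
  simp [elemsOf]

theorem isOutwardNormal {T : M.elems} {e : M.faces}
    (h : (e : Set (Pt d)) ⊆ frontier (T : Set (Pt d))) :
    IsOutwardNormal (T : Set (Pt d)) e (outwardNormal (T : Set (Pt d)) e) := by
  have h' := M.exists_normal T T.2 e e.2 h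
  rw [outwardNormal, dif_pos h']
  exact h'.choose_spec

/-- With a common outward normal, a short step inwards from a relative interior point of `e` would
land in the interiors of both elements, which are disjoint. -/
theorem outwardNormal_ne {T T' : M.elems} {e : M.faces} (hT : T ∈ M.elemsOf e)
    (hT' : T' ∈ M.elemsOf e) (hne : T ≠ T') :
    outwardNormal (T : Set (Pt d)) e ≠ outwardNormal (T' : Set (Pt d)) e := by
  intro h
  obtain ⟨x, hx⟩ := (M.face_polytope e e.2).connected.nonempty
  have h1 := (M.isOutwardNormal (M.mem_elemsOf.1 hT)).inside x hx
  have h2 := (M.isOutwardNormal (M.mem_elemsOf.1 hT')).inside x hx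
  rw [← h] at h2
  obtain ⟨t, ht, ht'⟩ := (h1.and h2).exists
  exact Set.disjoint_left.1
    (M.elem_disjoint T T.2 T' T'.2 fun h => hne (Subtype.ext h)) ht ht'

/-- Pigeonhole: a hyperplane has only two unit normals, and distinct elements at `e` have distinct
ones. -/
theorem card_elemsOf_le (hd : 0 < d) (e : M.faces) : (M.elemsOf e).card ≤ 2 := by
  by_contra! h
  obtain ⟨a, ha, b, hb, c, hc, hab, hac, hbc⟩ := Finset.two_lt_card.1 h
  have hn : ∀ {T T'}, T ∈ M.elemsOf e → T' ∈ M.elemsOf e → T ≠ T' →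
      outwardNormal (T : Set (Pt d)) e = -outwardNormal (T' : Set (Pt d)) e := by
    intro T T' hT hT' hne
    have h1 := M.isOutwardNormal (M.mem_elemsOf.1 hT)
    have h2 := M.isOutwardNormal (M.mem_elemsOf.1 hT')
    exact (eq_or_eq_neg_of_orthogonal hd (M.face_polytope e e.2).dim_eq h1.norm_eq h2.norm_eq
      h1.orthogonal h2.orthogonal).resolve_left (M.outwardNormal_ne hT hT' hne)
  exact M.outwardNormal_ne hb hc hbc
    ((hn hb ha hab.symm).trans (hn hc ha hac.symm).symm)

theorem face_subset_elem {T : M.elems} {e : M.faces}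
    (h : (e : Set (Pt d)) ⊆ frontier (T : Set (Pt d))) : (e : Set (Pt d)) ⊆ T :=
  h.trans (M.elem_polytope T T.2).isCompact.isClosed.frontier_subset

theorem elems_nonempty (hΩ : Ω.Nonempty) : Nonempty M.elems := by
  obtain ⟨x, hx⟩ := hΩ
  have h := subset_closure hx
  rw [← M.cover] at h
  simp only [Set.mem_iUnion] at h
  obtain ⟨T, hT, -⟩ := h
  exact ⟨⟨T, hT⟩⟩

end PolyMesh

/-! ### Polynomial vector fields and gradients. -/

theorem continuous_evalVec {d : ℕ} (p : Fin d → MvPolynomial (Fin d) ℝ) :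
    Continuous (evalVec p) :=
  (PiLp.continuous_toLp 2 _).comp (continuous_pi fun i => continuous_evalPoly (p i))

theorem continuous_gradPoly {d : ℕ} (q : MvPolynomial (Fin d) ℝ) : Continuous (gradPoly q) :=
  continuous_evalVec _

theorem evalVec_add {d : ℕ} (p q : Fin d → MvPolynomial (Fin d) ℝ) (x : Pt d) :
    evalVec (p + q) x = evalVec p x + evalVec q x := by
  ext i
  simp [evalVec]

theorem evalVec_smul {d : ℕ} (c : ℝ) (p : Fin d → MvPolynomial (Fin d) ℝ) (x : Pt d) :
    evalVec (c • p) x = c • evalVec p x := by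
  ext i
  simp [evalVec]

theorem norm_evalVec_sq {d : ℕ} (p : Fin d → MvPolynomial (Fin d) ℝ) (x : Pt d) :
    ‖evalVec p x‖ ^ 2 = ∑ i, evalPoly (p i) x ^ 2 := by
  rw [EuclideanSpace.real_norm_sq_eq]
  rfl

theorem gradPoly_add {d : ℕ} (p q : MvPolynomial (Fin d) ℝ) (x : Pt d) :
    gradPoly (p + q) x = gradPoly p x + gradPoly q x := by
  ext i
  simp [gradPoly, evalVec]

theorem gradPoly_smul {d : ℕ} (c : ℝ) (p : MvPolynomial (Fin d) ℝ) (x : Pt d) :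
    gradPoly (c • p) x = c • gradPoly p x := by
  ext i
  simp [gradPoly, evalVec]

/-! ### The face spaces and the projection onto them -/

/-- Rigid motions are affine, whence the degree `max (k - 1) 1`; for `k = 1` they are not in
`P_{k-1}`. This representation yields continuity on `e` and finite dimension of the face space. -/
theorem exists_evalVec_of_mem_faceSpace {d k : ℕ} {e : Set (Pt d)} {z : Pt d → Pt d}
    (hz : z ∈ faceSpace k e) : ∃ p : Fin d → MvPolynomial (Fin d) ℝ,
      (∀ i, p i ∈ MvPolynomial.restrictTotalDegree (Fin d) ℝ (max (k - 1) 1)) ∧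
        z = e.indicator (evalVec p) := by
  obtain ⟨_, ⟨p, hp, rfl⟩, _, ⟨a, η, -, rfl⟩, rfl⟩ := Submodule.mem_sup.1 hz
  refine ⟨p + fun i => MvPolynomial.C (a i) + ∑ j, MvPolynomial.C (η i j) * MvPolynomial.X j,
    fun i => Submodule.add_mem _ ?_ (Submodule.add_mem _ ?_ (Submodule.sum_mem _ fun j _ => ?_)), ?_⟩
  · have := hp i
    rw [MvPolynomial.mem_restrictTotalDegree] at this ⊢
    exact this.trans (le_max_left _ _)
  · simp [MvPolynomial.mem_restrictTotalDegree]
  · rw [MvPolynomial.mem_restrictTotalDegree]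
    refine (MvPolynomial.totalDegree_mul _ _).trans ?_
    simp
  · rw [← Set.indicator_add']
    refine congrArg _ (funext fun x => ?_)
    rw [evalVec_add, Pi.add_apply]
    congr 1
    ext i
    simp [rigidMotion, evalVec, Matrix.mulVec, dotProduct]

theorem continuousOn_of_mem_faceSpace {d k : ℕ} {e : Set (Pt d)} {z : Pt d → Pt d}
    (hz : z ∈ faceSpace k e) : ContinuousOn z e := by
  obtain ⟨p, -, rfl⟩ := exists_evalVec_of_mem_faceSpace hz
  exact (continuous_evalVec p).continuousOn.congr fun x hx => Set.indicator_of_mem hx _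

instance {d k : ℕ} {e : Set (Pt d)} : FiniteDimensional ℝ (faceSpace k e) := by
  let Φ : (Fin d → MvPolynomial.restrictTotalDegree (Fin d) ℝ (max (k - 1) 1)) →ₗ[ℝ]
      (Pt d → Pt d) :=
    { toFun := fun p => e.indicator (evalVec fun i => (p i : MvPolynomial (Fin d) ℝ))
      map_add' := fun p q => by
        rw [← Set.indicator_add']
        exact congrArg _ (funext fun x => evalVec_add _ _ x)
      map_smul' := fun c p => by
        refine Eq.trans (congrArg _ (funext fun x => evalVec_smul c _ x)) ?_
        exact Set.indicator_const_smul e c _ }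
  refine Submodule.finiteDimensional_of_le (S₂ := LinearMap.range Φ) fun z hz => ?_
  obtain ⟨p, hp, rfl⟩ := exists_evalVec_of_mem_faceSpace hz
  exact ⟨fun i => ⟨p i, hp i⟩, rfl⟩

section Face

variable {d k : ℕ} {e : Set (Pt d)}

theorem faceIntegral_add (he : IsPolytope (d - 1) e) {f g : Pt d → ℝ} (hf : ContinuousOn f e)
    (hg : ContinuousOn g e) :
    faceIntegral e (fun x => f x + g x) = faceIntegral e f + faceIntegral e g :=
  integral_add (he.integrableOn_face hf) (he.integrableOn_face hg)

theorem faceIntegral_const_mul (c : ℝ) (f : Pt d → ℝ) :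
    faceIntegral e (fun x => c * f x) = c * faceIntegral e f :=
  integral_const_mul _ _

theorem faceIntegral_mono (he : IsPolytope (d - 1) e) {f g : Pt d → ℝ} (hf : ContinuousOn f e)
    (hg : ContinuousOn g e) (h : ∀ x ∈ e, f x ≤ g x) : faceIntegral e f ≤ faceIntegral e g :=
  setIntegral_mono_on (he.integrableOn_face hf) (he.integrableOn_face hg)
    he.isCompact.measurableSet h

theorem faceIntegral_congr (he : IsPolytope (d - 1) e) {f g : Pt d → ℝ}
    (h : ∀ x ∈ e, f x = g x) : faceIntegral e f = faceIntegral e g :=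
  setIntegral_congr_fun he.isCompact.measurableSet h

theorem faceIntegral_nonneg {f : Pt d → ℝ} (h : ∀ x, 0 ≤ f x) : 0 ≤ faceIntegral e f :=
  integral_nonneg h

theorem memLp_of_continuousOn (he : IsPolytope (d - 1) e) {f : Pt d → Pt d}
    (hf : ContinuousOn f e) : MemLp f 2
      ((Measure.euclideanHausdorffMeasure (d - 1) : Measure (Pt d)).restrict e) := by
  rw [memLp_two_iff_integrable_sq_norm (he.integrableOn_face hf).aestronglyMeasurable]
  exact he.integrableOn_face (hf.norm.pow 2)

/-- The image of the face space in `L²(e)` is finite-dimensional, so the Hilbert space projection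
onto it exists and is the class of an element of the face space. -/
theorem exists_isFaceProj (he : IsPolytope (d - 1) e) {w : Pt d → Pt d} (hw : ContinuousOn w e) :
    ∃ u, IsFaceProj k e w u := by
  set ν := (Measure.euclideanHausdorffMeasure (d - 1) : Measure (Pt d)).restrict e with hν
  let Λ : faceSpace k e →ₗ[ℝ] Lp (Pt d) 2 ν :=
    { toFun := fun z => (memLp_of_continuousOn he (continuousOn_of_mem_faceSpace z.2)).toLp z
      map_add' := fun z z' => MemLp.toLp_add _ _
      map_smul' := fun c z => MemLp.toLp_const_smul _ _ }
  have hwL := memLp_of_continuousOn he hw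
  obtain ⟨u, hu⟩ : (LinearMap.range Λ).starProjection (hwL.toLp w) ∈ LinearMap.range Λ :=
    Submodule.starProjection_apply_mem _ _
  refine ⟨u, u.2, fun z hz => ?_⟩
  have h := Submodule.starProjection_inner_eq_zero (K := LinearMap.range Λ) (hwL.toLp w)
    (Λ ⟨z, hz⟩) ⟨_, rfl⟩
  rw [← hu, L2.inner_def] at h
  rw [← h, faceIntegral]
  refine integral_congr_ae ?_
  have huL := memLp_of_continuousOn he (continuousOn_of_mem_faceSpace u.2)
  have hzL := memLp_of_continuousOn he (continuousOn_of_mem_faceSpace hz)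
  filter_upwards [hwL.coeFn_toLp, huL.coeFn_toLp, Lp.coeFn_sub (hwL.toLp w) (Λ u),
    hzL.coeFn_toLp] with x h1 h2 h3 h4
  rw [h3, Pi.sub_apply, h1]
  change _ = inner ℝ (w x - (huL.toLp u) x) ((hzL.toLp z) x)
  rw [h2, h4]

theorem isFaceProj_faceProj (he : IsPolytope (d - 1) e) {w : Pt d → Pt d}
    (hw : ContinuousOn w e) : IsFaceProj k e w (faceProj k e w) := by
  have h := exists_isFaceProj (k := k) he hw
  rw [faceProj, dif_pos h]
  exact h.choose_spec

theorem continuousOn_faceProj (he : IsPolytope (d - 1) e) {w : Pt d → Pt d}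
    (hw : ContinuousOn w e) : ContinuousOn (faceProj k e w) e :=
  continuousOn_of_mem_faceSpace (isFaceProj_faceProj he hw).1

theorem faceIntegral_norm_faceProj_sq_le (he : IsPolytope (d - 1) e) {w : Pt d → Pt d}
    (hw : ContinuousOn w e) :
    faceIntegral e (fun x => ‖faceProj k e w x‖ ^ 2) ≤ faceIntegral e fun x => ‖w x‖ ^ 2 := by
  have hQ := isFaceProj_faceProj (k := k) he hw
  set u := faceProj k e w
  have hu : ContinuousOn u e := continuousOn_of_mem_faceSpace hQ.1
  -- Expand `‖(w - u) + u‖²` and drop `‖w - u‖²`; the cross term integrates to zero because `u` is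
  -- itself in the face space.
  have h1 : faceIntegral e (fun x => ‖u x‖ ^ 2 + 2 * inner ℝ (w x - u x) (u x)) ≤
      faceIntegral e fun x => ‖w x‖ ^ 2 := by
    refine faceIntegral_mono he (by fun_prop) (by fun_prop) fun x _ => ?_
    have h2 := norm_add_sq_real (w x - u x) (u x)
    rw [sub_add_cancel] at h2
    nlinarith [sq_nonneg ‖w x - u x‖]
  rwa [faceIntegral_add he (by fun_prop) (by fun_prop), faceIntegral_const_mul, hQ.2 u hQ.1,
    mul_zero, add_zero] at h1

theorem faceIntegral_norm_faceProj_sub_sq_le (he : IsPolytope (d - 1) e) {w b : Pt d → Pt d}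
    (hw : ContinuousOn w e) (hb : ContinuousOn b e) :
    faceIntegral e (fun x => ‖faceProj k e w x - b x‖ ^ 2) ≤
      2 * faceIntegral e (fun x => ‖w x‖ ^ 2) + 2 * faceIntegral e fun x => ‖b x‖ ^ 2 := by
  have hu : ContinuousOn (faceProj k e w) e := continuousOn_faceProj he hw
  have h1 : faceIntegral e (fun x => ‖faceProj k e w x - b x‖ ^ 2) ≤
      faceIntegral e fun x => 2 * ‖faceProj k e w x‖ ^ 2 + 2 * ‖b x‖ ^ 2 := by
    refine faceIntegral_mono he (by fun_prop) (by fun_prop) fun x _ => ?_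
    nlinarith [sq_nonneg ‖faceProj k e w x + b x‖,
      parallelogram_law_with_norm ℝ (faceProj k e w x) (b x)]
  rw [faceIntegral_add he (by fun_prop) (by fun_prop), faceIntegral_const_mul,
    faceIntegral_const_mul] at h1
  linarith [faceIntegral_norm_faceProj_sq_le (k := k) he hw]

/-- `faceProj` is a chosen representative, so linearity is proved only almost everywhere, which
suffices under integrals. The difference `D` of the two sides lies in the face space and is
orthogonal to it, hence to itself. -/
theorem faceProj_linearCombination_ae (he : IsPolytope (d - 1) e) {v w : Pt d → Pt d}
    (hv : ContinuousOn v e) (hw : ContinuousOn w e) (a b : ℝ) :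
    ∀ᵐ x ∂(Measure.euclideanHausdorffMeasure (d - 1) : Measure (Pt d)).restrict e,
      faceProj k e (a • v + b • w) x = a • faceProj k e v x + b • faceProj k e w x := by
  have hs := isFaceProj_faceProj (k := k) he
    (show ContinuousOn (a • v + b • w) e from (hv.const_smul a).add (hw.const_smul b))
  have hv' := isFaceProj_faceProj (k := k) he hv
  have hw' := isFaceProj_faceProj (k := k) he hw
  set s := faceProj k e (a • v + b • w)
  set u := faceProj k e v
  set u' := faceProj k e w
  set D : Pt d → Pt d := a • u + b • u' - s with hD
  have hDm : D ∈ faceSpace k e := Submodule.sub_mem _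
    (Submodule.add_mem _ (Submodule.smul_mem _ _ hv'.1) (Submodule.smul_mem _ _ hw'.1)) hs.1
  have cs := continuousOn_of_mem_faceSpace hs.1
  have cu := continuousOn_of_mem_faceSpace hv'.1
  have cu' := continuousOn_of_mem_faceSpace hw'.1
  have cD := continuousOn_of_mem_faceSpace hDm
  have h0 : faceIntegral e (fun x => ‖D x‖ ^ 2) = 0 := by
    have h1 : faceIntegral e (fun x => ‖D x‖ ^ 2) = faceIntegral e fun x =>
        inner ℝ ((a • v + b • w) x - s x) (D x) +
          ((-a) * inner ℝ (v x - u x) (D x) + (-b) * inner ℝ (w x - u' x) (D x)) := by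
      refine faceIntegral_congr he fun x _ => ?_
      rw [← real_inner_self_eq_norm_sq, ← real_inner_smul_left, ← real_inner_smul_left,
        ← inner_add_left, ← inner_add_left]
      congr 1
      simp only [hD, Pi.add_apply, Pi.sub_apply, Pi.smul_apply]
      module
    have cavw : ContinuousOn (a • v + b • w) e := (hv.const_smul a).add (hw.const_smul b)
    rw [h1, faceIntegral_add he (by fun_prop) (by fun_prop),
      faceIntegral_add he (by fun_prop) (by fun_prop), faceIntegral_const_mul,
      faceIntegral_const_mul, hs.2 D hDm, hv'.2 D hDm, hw'.2 D hDm]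
    simp
  have h1 := (integral_eq_zero_iff_of_nonneg (fun x => sq_nonneg ‖D x‖)
    (he.integrableOn_face (cD.norm.pow 2))).1 h0
  filter_upwards [h1] with x hx
  have hx' : D x = 0 := by simpa using hx
  exact (sub_eq_zero.1 hx').symm

theorem faceIntegral_faceProj_linearCombination_le (he : IsPolytope (d - 1) e)
    {v w c c' : Pt d → Pt d} (hv : ContinuousOn v e) (hw : ContinuousOn w e)
    (hc : ContinuousOn c e) (hc' : ContinuousOn c' e) (a b : ℝ) :
    faceIntegral e (fun x => ‖faceProj k e (a • v + b • w) x - (a • c + b • c') x‖ ^ 2) ≤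
      2 * a ^ 2 * faceIntegral e (fun x => ‖faceProj k e v x - c x‖ ^ 2) +
      2 * b ^ 2 * faceIntegral e (fun x => ‖faceProj k e w x - c' x‖ ^ 2) := by
  have cu := continuousOn_faceProj (k := k) he hv
  have cu' := continuousOn_faceProj (k := k) he hw
  have h1 : faceIntegral e (fun x => ‖faceProj k e (a • v + b • w) x - (a • c + b • c') x‖ ^ 2) =
      faceIntegral e fun x =>
        ‖a • (faceProj k e v x - c x) + b • (faceProj k e w x - c' x)‖ ^ 2 := by
    refine integral_congr_ae ?_
    filter_upwards [faceProj_linearCombination_ae (k := k) he hv hw a b] with x hx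
    rw [hx]
    congr 2
    simp only [Pi.add_apply, Pi.smul_apply]
    module
  rw [h1, ← faceIntegral_const_mul, ← faceIntegral_const_mul,
    ← faceIntegral_add he (by fun_prop) (by fun_prop)]
  refine faceIntegral_mono he (by fun_prop) (by fun_prop) fun x _ => ?_
  have h2 := parallelogram_law_with_norm ℝ (a • (faceProj k e v x - c x))
    (b • (faceProj k e w x - c' x))
  rw [norm_smul a, norm_smul b, Real.norm_eq_abs, Real.norm_eq_abs] at h2
  have h3 := sq_abs a
  have h4 := sq_abs b
  have h5 := sq_nonneg ‖a • (faceProj k e v x - c x) - b • (faceProj k e w x - c' x)‖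
  rw [← h3, ← h4]
  nlinarith

end Face

/-! ### Existence of the weak divergence; algebra of `b` and of the norm on `V_h`. -/

theorem surjective_of_anisotropic {V : Type*} [AddCommGroup V] [Module ℝ V]
    [FiniteDimensional ℝ V] (B : V →ₗ[ℝ] Module.Dual ℝ V) (hB : ∀ p, B p p = 0 → p = 0) :
    Function.Surjective B := by
  refine (LinearMap.injective_iff_surjective_of_finrank_eq_finrank
    Subspace.dual_finrank_eq.symm).1 ?_
  rw [injective_iff_map_eq_zero]
  intro p hp
  exact hB p (by rw [hp, LinearMap.zero_apply])

/-- A polynomial whose square integral over a set of positive measure vanishes is zero. -/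
theorem eq_zero_of_setIntegral_sq_eq_zero {d : ℕ} {A : Set (Pt d)} (hA : IsCompact A)
    (hpos : 0 < volume A) {p : MvPolynomial (Fin d) ℝ}
    (h : ∫ x in A, evalPoly p x * evalPoly p x = 0) : p = 0 := by
  by_contra hp
  have h1 := (integral_eq_zero_iff_of_nonneg (fun x => mul_self_nonneg (evalPoly p x))
    (((continuous_evalPoly p).mul (continuous_evalPoly p)).continuousOn.integrableOn_compact hA)).1 h
  have h2 : ∀ᵐ x ∂(volume.restrict A), x ∉ {x : Pt d | evalPoly p x = 0} :=
    ae_restrict_of_ae (measure_eq_zero_iff_ae_notMem.1 (volume_zeros_eq_zero hp))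
  have h3 : ∀ᵐ x ∂(volume.restrict A), False := by
    filter_upwards [h1, h2] with x hx hx'
    exact hx' (mul_self_eq_zero.1 hx)
  rw [eventually_false_iff_eq_bot, ae_eq_bot, Measure.restrict_eq_zero] at h3
  exact hpos.ne' h3

namespace PolyMesh

variable {d : ℕ} {Ω : Set (Pt d)} (M : PolyMesh Ω)

theorem isCompact_elem (T : M.elems) : IsCompact (T : Set (Pt d)) :=
  (M.elem_polytope T T.2).isCompact

theorem integrableOn_elem (T : M.elems) {f : Pt d → ℝ} (hf : Continuous f) :
    IntegrableOn f (T : Set (Pt d)) :=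
  hf.continuousOn.integrableOn_compact (M.isCompact_elem T)

/-- The `L²(T)` pairing `B` on `P_r(T)` is anisotropic since `T` has positive volume, so it
represents every functional, in particular the right-hand side `ℓ` of the defining identity. -/
theorem exists_isWeakDiv (r : ℕ) (T : M.elems) {v₀ : Pt d → Pt d} (hv₀ : Continuous v₀)
    {vb : M.faces → Pt d → Pt d} (hvb : ∀ e : M.faces, ContinuousOn (vb e) (e : Set (Pt d))) :
    ∃ p, M.IsWeakDiv r T v₀ vb p := by
  have hc := fun p : MvPolynomial (Fin d) ℝ => continuous_evalPoly p
  have hcc : ∀ p q : MvPolynomial (Fin d) ℝ, Continuous fun x => evalPoly p x * evalPoly q x :=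
    fun p q => (hc p).mul (hc q)
  have hg := fun p : MvPolynomial (Fin d) ℝ => continuous_gradPoly p
  have he := fun e : M.faces => M.face_polytope e e.2
  let B : MvPolynomial.restrictTotalDegree (Fin d) ℝ r →ₗ[ℝ]
      Module.Dual ℝ (MvPolynomial.restrictTotalDegree (Fin d) ℝ r) :=
    LinearMap.mk₂ ℝ (fun p φ => ∫ x in (T : Set (Pt d)),
        evalPoly (p : MvPolynomial (Fin d) ℝ) x * evalPoly (φ : MvPolynomial (Fin d) ℝ) x)
      (fun p p' φ => by
        rw [← integral_add (M.integrableOn_elem T (hcc _ _))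
          (M.integrableOn_elem T (hcc _ _))]
        simp only [Submodule.coe_add, evalPoly_add, add_mul])
      (fun c p φ => by
        rw [smul_eq_mul, ← integral_const_mul]
        simp only [Submodule.coe_smul, evalPoly_smul, mul_assoc])
      (fun p φ φ' => by
        rw [← integral_add (M.integrableOn_elem T (hcc _ _))
          (M.integrableOn_elem T (hcc _ _))]
        simp only [Submodule.coe_add, evalPoly_add, mul_add])
      (fun c p φ => by
        rw [smul_eq_mul, ← integral_const_mul]
        simp only [Submodule.coe_smul, evalPoly_smul, mul_left_comm])
  let ℓ : Module.Dual ℝ (MvPolynomial.restrictTotalDegree (Fin d) ℝ r) :=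
    { toFun := fun φ =>
        -(∫ x in (T : Set (Pt d)), inner ℝ (v₀ x) (gradPoly (φ : MvPolynomial (Fin d) ℝ) x)) +
        ∑ e ∈ M.facesOf T, faceIntegral (e : Set (Pt d)) (fun x =>
          inner ℝ (vb e x) (outwardNormal (T : Set (Pt d)) e) *
            evalPoly (φ : MvPolynomial (Fin d) ℝ) x)
      map_add' := fun φ φ' => by
        simp only [Submodule.coe_add, gradPoly_add, evalPoly_add, mul_add, inner_add_right]
        rw [integral_add (M.integrableOn_elem T (hv₀.inner (hg _)))
          (M.integrableOn_elem T (hv₀.inner (hg _)))]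
        have h1 : ∀ e : M.faces, faceIntegral (e : Set (Pt d)) (fun x =>
            inner ℝ (vb e x) (outwardNormal (T : Set (Pt d)) e) * evalPoly (φ : MvPolynomial _ ℝ) x +
            inner ℝ (vb e x) (outwardNormal (T : Set (Pt d)) e) * evalPoly (φ' : MvPolynomial _ ℝ) x)
            = _ := fun e => faceIntegral_add (he e)
              (((hvb e).inner continuousOn_const).mul (hc _).continuousOn)
              (((hvb e).inner continuousOn_const).mul (hc _).continuousOn)
        simp only [h1, Finset.sum_add_distrib]
        ring
      map_smul' := fun c φ => by
        simp only [Submodule.coe_smul, gradPoly_smul, evalPoly_smul, inner_smul_right,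
          mul_left_comm _ c, integral_const_mul, faceIntegral_const_mul, ← Finset.mul_sum,
          RingHom.id_apply, smul_eq_mul]
        ring }
  obtain ⟨p, hp⟩ := surjective_of_anisotropic B (fun p hp => Subtype.ext
    (eq_zero_of_setIntegral_sq_eq_zero (M.isCompact_elem T) (M.elem_polytope T T.2).volume_pos hp)) ℓ
  exact ⟨p, p.2, fun φ hφ => LinearMap.congr_fun hp ⟨φ, hφ⟩⟩

theorem continuousOn_of_mem_Vh {k : ℕ} {v : M.WeakField} (hv : v ∈ M.Vh k) (e : M.faces) :
    ContinuousOn (v.2 e) (e : Set (Pt d)) :=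
  continuousOn_of_mem_faceSpace (hv.2 e)

/-- The form `b(v, q)` in terms of `v` itself. -/
theorem bForm_eq {k : ℕ} {v : M.WeakField} (hv : v ∈ M.Vh k)
    {q : M.elems → MvPolynomial (Fin d) ℝ} (hq : q ∈ M.Wh k) :
    M.bForm k v q = ∑ T : M.elems,
      (-(∫ x in (T : Set (Pt d)), inner ℝ (evalVec (v.1 T) x) (gradPoly (q T) x)) +
        ∑ e ∈ M.facesOf T, faceIntegral (e : Set (Pt d)) (fun x =>
          inner ℝ (v.2 e x) (outwardNormal (T : Set (Pt d)) e) * evalPoly (q T) x)) := by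
  refine Finset.sum_congr rfl fun T _ => ?_
  have h := M.exists_isWeakDiv (k - 1) T (continuous_evalVec (v.1 T)) (M.continuousOn_of_mem_Vh hv)
  rw [weakDiv, dif_pos h]
  exact h.choose_spec.2 (q T) (hq T (Set.mem_univ T))

theorem bForm_add_smul {k : ℕ} {v w : M.WeakField} (hv : v ∈ M.Vh k) (hw : w ∈ M.Vh k)
    {q : M.elems → MvPolynomial (Fin d) ℝ} (hq : q ∈ M.Wh k) (t : ℝ) :
    M.bForm k (v + t • w) q = M.bForm k v q + t * M.bForm k w q := by
  rw [M.bForm_eq hv hq, M.bForm_eq hw hq,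
    M.bForm_eq (Submodule.add_mem _ hv (Submodule.smul_mem _ t hw)) hq, Finset.mul_sum,
    ← Finset.sum_add_distrib]
  refine Finset.sum_congr rfl fun T _ => ?_
  have h1 : ∫ x in (T : Set (Pt d)), inner ℝ (evalVec ((v + t • w).1 T) x) (gradPoly (q T) x) =
      (∫ x in (T : Set (Pt d)), inner ℝ (evalVec (v.1 T) x) (gradPoly (q T) x)) +
      t * ∫ x in (T : Set (Pt d)), inner ℝ (evalVec (w.1 T) x) (gradPoly (q T) x) := by
    rw [← integral_const_mul, ← integral_add
      (M.integrableOn_elem T ((continuous_evalVec _).inner (continuous_gradPoly _)))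
      ((M.integrableOn_elem T ((continuous_evalVec _).inner (continuous_gradPoly _))).const_mul t)]
    refine integral_congr_ae (Eventually.of_forall fun x => ?_)
    change inner ℝ (evalVec (v.1 T + t • w.1 T) x) (gradPoly (q T) x) = _
    rw [evalVec_add, evalVec_smul, inner_add_left, real_inner_smul_left]
  have h2 : ∀ e : M.faces, faceIntegral (e : Set (Pt d)) (fun x =>
      inner ℝ ((v + t • w).2 e x) (outwardNormal (T : Set (Pt d)) e) * evalPoly (q T) x) =
      faceIntegral (e : Set (Pt d)) (fun x =>
        inner ℝ (v.2 e x) (outwardNormal (T : Set (Pt d)) e) * evalPoly (q T) x) +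
      t * faceIntegral (e : Set (Pt d)) (fun x =>
        inner ℝ (w.2 e x) (outwardNormal (T : Set (Pt d)) e) * evalPoly (q T) x) := by
    intro e
    have hc := (continuous_evalPoly (q T)).continuousOn (s := (e : Set (Pt d)))
    have hcv := M.continuousOn_of_mem_Vh hv e
    have hcw := M.continuousOn_of_mem_Vh hw e
    rw [← faceIntegral_const_mul, ← faceIntegral_add (M.face_polytope e e.2)
      (by fun_prop) (by fun_prop)]
    refine faceIntegral_congr (M.face_polytope e e.2) fun x _ => ?_
    change inner ℝ (v.2 e x + t • w.2 e x) _ * _ = _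
    rw [inner_add_left, real_inner_smul_left]
    ring
  rw [h1, Finset.sum_congr rfl fun e _ => h2 e, Finset.sum_add_distrib, ← Finset.mul_sum]
  ring

theorem continuous_strain (p : Fin d → MvPolynomial (Fin d) ℝ) (i j : Fin d) :
    Continuous fun x => strain p x i j := by
  have h1 := continuous_evalPoly (MvPolynomial.pderiv j (p i))
  have h2 := continuous_evalPoly (MvPolynomial.pderiv i (p j))
  simp only [strain, Matrix.of_apply]
  fun_prop

/-- The contribution of the element `T` to the square of the norm of `v`. -/
def normVSq (k : ℕ) (v : M.WeakField) (T : M.elems) : ℝ :=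
  (∫ x in (T : Set (Pt d)), ∑ i, ∑ j, strain (v.1 T) x i j ^ 2) +
    (Metric.diam (T : Set (Pt d)))⁻¹ * ∑ e ∈ M.facesOf T, faceIntegral (e : Set (Pt d))
      (fun x => ‖faceProj k (e : Set (Pt d)) (evalVec (v.1 T)) x - v.2 e x‖ ^ 2)

theorem setIntegral_strain_nonneg (p : Fin d → MvPolynomial (Fin d) ℝ) (A : Set (Pt d)) :
    0 ≤ ∫ x in A, ∑ i, ∑ j, strain p x i j ^ 2 :=
  integral_nonneg fun _ => Finset.sum_nonneg fun _ _ => Finset.sum_nonneg fun _ _ => sq_nonneg _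

theorem faceTerms_nonneg (k : ℕ) (v : M.WeakField) (T : M.elems) :
    0 ≤ (Metric.diam (T : Set (Pt d)))⁻¹ * ∑ e ∈ M.facesOf T, faceIntegral (e : Set (Pt d))
      (fun x => ‖faceProj k (e : Set (Pt d)) (evalVec (v.1 T)) x - v.2 e x‖ ^ 2) :=
  mul_nonneg (inv_nonneg.2 Metric.diam_nonneg) (Finset.sum_nonneg fun _ _ =>
    faceIntegral_nonneg fun _ => sq_nonneg _)

theorem normVSq_nonneg (k : ℕ) (v : M.WeakField) (T : M.elems) : 0 ≤ M.normVSq k v T :=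
  add_nonneg (setIntegral_strain_nonneg _ _) (M.faceTerms_nonneg k v T)

theorem normV_sq (k : ℕ) (v : M.WeakField) : M.normV k v ^ 2 = ∑ T : M.elems, M.normVSq k v T :=
  Real.sq_sqrt (Finset.sum_nonneg fun T _ => M.normVSq_nonneg k v T)

theorem normV_nonneg (k : ℕ) (v : M.WeakField) : 0 ≤ M.normV k v := Real.sqrt_nonneg _

/-- A substitute for the triangle inequality, from `(x + y)² ≤ 2x² + 2y²` term by term. It is all
that the perturbation argument for a test field of norm zero requires. -/
theorem normV_linearCombination_sq_le {k : ℕ} {v w : M.WeakField} (hv : v ∈ M.Vh k)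
    (hw : w ∈ M.Vh k) (a b : ℝ) :
    M.normV k (a • v + b • w) ^ 2 ≤ 2 * a ^ 2 * M.normV k v ^ 2 + 2 * b ^ 2 * M.normV k w ^ 2 := by
  simp only [normV_sq, Finset.mul_sum, ← Finset.sum_add_distrib]
  refine Finset.sum_le_sum fun T _ => ?_
  have h1 : ∫ x in (T : Set (Pt d)), ∑ i, ∑ j, strain ((a • v + b • w).1 T) x i j ^ 2 ≤
      2 * a ^ 2 * (∫ x in (T : Set (Pt d)), ∑ i, ∑ j, strain (v.1 T) x i j ^ 2) +
      2 * b ^ 2 * ∫ x in (T : Set (Pt d)), ∑ i, ∑ j, strain (w.1 T) x i j ^ 2 := by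
    have hint : ∀ p : Fin d → MvPolynomial (Fin d) ℝ,
        IntegrableOn (fun x => ∑ i, ∑ j, strain p x i j ^ 2) (T : Set (Pt d)) := fun p =>
      M.integrableOn_elem T (continuous_finsetSum _ fun i _ => continuous_finsetSum _ fun j _ =>
        (continuous_strain p i j).pow 2)
    rw [← integral_const_mul, ← integral_const_mul, ← integral_add ((hint _).const_mul _)
      ((hint _).const_mul _)]
    refine setIntegral_mono (hint _) (((hint _).const_mul _).add ((hint _).const_mul _)) fun x => ?_
    simp only [Finset.mul_sum, ← Finset.sum_add_distrib]
    refine Finset.sum_le_sum fun i _ => Finset.sum_le_sum fun j _ => ?_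
    have h2 : strain ((a • v + b • w).1 T) x i j =
        a * strain (v.1 T) x i j + b * strain (w.1 T) x i j := by
      change strain (a • v.1 T + b • w.1 T) x i j = _
      simp only [strain, Matrix.of_apply, Pi.add_apply, Pi.smul_apply, map_add, Derivation.map_smul,
        evalPoly_add, evalPoly_smul]
      ring
    rw [h2]
    nlinarith [sq_nonneg (a * strain (v.1 T) x i j - b * strain (w.1 T) x i j)]
  have h3 : ∀ e : M.faces, faceIntegral (e : Set (Pt d)) (fun x =>
      ‖faceProj k (e : Set (Pt d)) (evalVec ((a • v + b • w).1 T)) x - (a • v + b • w).2 e x‖ ^ 2) ≤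
      2 * a ^ 2 * faceIntegral (e : Set (Pt d)) (fun x =>
        ‖faceProj k (e : Set (Pt d)) (evalVec (v.1 T)) x - v.2 e x‖ ^ 2) +
      2 * b ^ 2 * faceIntegral (e : Set (Pt d)) (fun x =>
        ‖faceProj k (e : Set (Pt d)) (evalVec (w.1 T)) x - w.2 e x‖ ^ 2) := by
    intro e
    have h4 : evalVec ((a • v + b • w).1 T) = a • evalVec (v.1 T) + b • evalVec (w.1 T) := by
      funext x
      change evalVec (a • v.1 T + b • w.1 T) x = _
      rw [evalVec_add, evalVec_smul, evalVec_smul]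
      rfl
    rw [h4]
    exact faceIntegral_faceProj_linearCombination_le (M.face_polytope e e.2)
      (continuous_evalVec _).continuousOn (continuous_evalVec _).continuousOn
      (M.continuousOn_of_mem_Vh hv e) (M.continuousOn_of_mem_Vh hw e) a b
  have h5 := mul_le_mul_of_nonneg_left (Finset.sum_le_sum fun e (_ : e ∈ M.facesOf T) => h3 e)
    (inv_nonneg.2 (Metric.diam_nonneg (s := (T : Set (Pt d)))))
  rw [Finset.sum_add_distrib, ← Finset.mul_sum, ← Finset.mul_sum] at h5
  unfold normVSq
  linarith

end PolyMesh

/-! ### Inverse and trace inequalities. -/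

/-- Inverse and trace inequalities for polynomials on a polytope `T` with `|T| ≥ ρ h_T ^ d`. -/
theorem exists_inverse_trace_bound {d : ℕ} (hd : 0 < d) (m : ℕ) {ρ : ℝ} (hρ : 0 < ρ) :
    ∃ C > 0, ∀ T : Set (Pt d), IsPolytope d T →
      ρ * Metric.diam T ^ d ≤ volume.real T →
      ∀ p ∈ MvPolynomial.restrictTotalDegree (Fin d) ℝ m,
        (∀ i, Metric.diam T ^ 2 * ∫ x in T, evalPoly (MvPolynomial.pderiv i p) x ^ 2 ≤
          C * ∫ x in T, evalPoly p x ^ 2) ∧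
        ∀ e ⊆ T, IsPolytope (d - 1) e →
          Metric.diam T * faceIntegral e (fun x => evalPoly p x ^ 2) ≤
            C * ∫ x in T, evalPoly p x ^ 2 := by
  obtain ⟨C, hC, hC'⟩ := exists_sq_le_setIntegral d m hρ
  set ω := volume.real (Metric.closedBall (0 : Pt d) 1)
  set ω' := volume.real (Metric.closedBall (0 : Pt (d - 1)) 1)
  refine ⟨(ω + ω' + 1) * C, by positivity, fun T hT hTρ p hp => ?_⟩
  set h := Metric.diam T
  have hh : 0 < h := hT.diam_pos hd
  have hb : ∀ x₀ ∈ T, T ⊆ Metric.closedBall x₀ h := fun x₀ hx₀ x hx =>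
    Metric.dist_le_diam_of_mem hT.isCompact.isBounded hx hx₀
  set I := ∫ x in T, evalPoly p x ^ 2
  have hI : 0 ≤ I := integral_nonneg fun x => sq_nonneg _
  -- The ball of radius `h` centred at `x` itself contains `T`, so the geometry of `T` enters only
  -- through its volume. Integrating this over `T` (volume at most `ω h ^ d`) or over `e` (measure
  -- at most `ω' h ^ (d - 1)`) gives the two inequalities.
  have hpt : ∀ x ∈ T, h ^ d * evalPoly p x ^ 2 ≤ C * I ∧
      ∀ i, h ^ d * (h ^ 2 * evalPoly (MvPolynomial.pderiv i p) x ^ 2) ≤ C * I := fun x hx =>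
    hC' p hp x h hh T (hb x hx) hT.isCompact.measurableSet hTρ x
      (Metric.mem_closedBall_self hh.le)
  refine ⟨fun i => ?_, fun e heT he => ?_⟩
  · obtain ⟨x₀, hx₀⟩ := hT.nonempty
    have hvol : volume.real T ≤ h ^ d * ω := by
      have h1 := measureReal_mono (μ := volume) (hb x₀ hx₀) (isCompact_closedBall x₀ h).measure_ne_top
      rwa [Measure.addHaar_real_closedBall' _ _ hh.le, finrank_euclideanSpace_fin] at h1
    have h2 : h ^ d * (h ^ 2 * ∫ x in T, evalPoly (MvPolynomial.pderiv i p) x ^ 2) ≤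
        volume.real T * (C * I) := by
      rw [← integral_const_mul, ← integral_const_mul, ← smul_eq_mul (volume.real T),
        ← setIntegral_const]
      refine setIntegral_mono_on ?_ ?_ hT.isCompact.measurableSet fun x hx => (hpt x hx).2 i
      · have := continuous_evalPoly (MvPolynomial.pderiv i p)
        exact ContinuousOn.integrableOn_compact hT.isCompact (by fun_prop)
      · exact continuousOn_const.integrableOn_compact hT.isCompact
    refine le_of_mul_le_mul_left (h2.trans ?_) (pow_pos hh d)
    calc volume.real T * (C * I) ≤ h ^ d * ω * (C * I) := by gcongr
      _ ≤ h ^ d * (ω + ω' + 1) * (C * I) := by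
        have : 0 ≤ ω' := measureReal_nonneg
        gcongr
        linarith
      _ = h ^ d * ((ω + ω' + 1) * C * I) := by ring
  · obtain ⟨x₀, hx₀⟩ := he.nonempty
    have hvol : (Measure.euclideanHausdorffMeasure (d - 1) : Measure (Pt d)).real e ≤
        h ^ (d - 1) * ω' := by
      have h1 := he.euclideanHausdorffMeasure_le hx₀ hh.le (heT.trans (hb x₀ (heT hx₀)))
      have h2 := ENNReal.toReal_mono (ENNReal.mul_ne_top ENNReal.ofReal_ne_top
        (isCompact_closedBall (0 : Pt (d - 1)) 1).measure_ne_top) h1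
      rwa [ENNReal.toReal_mul, ENNReal.toReal_ofReal (by positivity)] at h2
    have h2 : h ^ d * faceIntegral e (fun x => evalPoly p x ^ 2) ≤
        (Measure.euclideanHausdorffMeasure (d - 1) : Measure (Pt d)).real e * (C * I) := by
      have hc := continuous_evalPoly p
      rw [← faceIntegral_const_mul, ← smul_eq_mul _ (C * I), ← setIntegral_const]
      exact faceIntegral_mono he (by fun_prop) continuousOn_const fun x hx => (hpt x (heT hx)).1
    have hpow : h ^ d = h ^ (d - 1) * h := by rw [← pow_succ, Nat.sub_add_cancel hd]
    refine le_of_mul_le_mul_left ?_ (pow_pos hh (d - 1))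
    rw [← mul_assoc, ← hpow]
    refine h2.trans ?_
    calc _ ≤ h ^ (d - 1) * ω' * (C * I) := by gcongr
      _ ≤ h ^ (d - 1) * (ω + ω' + 1) * (C * I) := by
        have : 0 ≤ ω := measureReal_nonneg
        gcongr
        linarith
      _ = h ^ (d - 1) * ((ω + ω' + 1) * C * I) := by ring

/-! ### The test field: its pairing with `q` and its norm. -/

namespace PolyMesh

variable {d : ℕ} {Ω : Set (Pt d)} (M : PolyMesh Ω)

/-- The jump of `q` across `e` as a polynomial vector field. -/
def jumpPoly (q : M.elems → MvPolynomial (Fin d) ℝ) (e : M.faces) :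
    Fin d → MvPolynomial (Fin d) ℝ :=
  fun i => ∑ T ∈ M.elemsOf e, outwardNormal (T : Set (Pt d)) e i • q T

theorem evalVec_jumpPoly (q : M.elems → MvPolynomial (Fin d) ℝ) (e : M.faces) :
    evalVec (M.jumpPoly q e) = M.jump q e := by
  funext x
  ext i
  change evalPoly (M.jumpPoly q e i) x = _
  rw [jumpPoly, evalPoly_sum, jump, WithLp.ofLp_sum, Finset.sum_apply]
  refine Finset.sum_congr rfl fun T _ => ?_
  rw [evalPoly_smul, PiLp.smul_apply, smul_eq_mul, mul_comm]

theorem continuous_jump (q : M.elems → MvPolynomial (Fin d) ℝ) (e : M.faces) :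
    Continuous (M.jump q e) := by
  rw [← evalVec_jumpPoly]
  exact continuous_evalVec _

open scoped Classical in
/-- The field `v` with `b(v, q) = |||q|||₀²`: `v₀ = -h² ∇ q` on the elements, and `v_b` is `h` times
the jump of `q` on the interior faces. -/
def testField (q : M.elems → MvPolynomial (Fin d) ℝ) : M.WeakField :=
  (fun T i => (-(M.meshSize ^ 2)) • MvPolynomial.pderiv i (q T),
   fun e => if (e : Set (Pt d)) ⊆ frontier Ω then 0 else
     (e : Set (Pt d)).indicator (evalVec (M.meshSize • M.jumpPoly q e)))

/-- `∇q` has degree at most `k - 1 ≤ k`, and, normals being constant on a flat face, the jump is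
already in `[P_{k-1}(e)]^d`; the rigid motions are not needed. -/
theorem testField_mem_Vh0 {k : ℕ} {q : M.elems → MvPolynomial (Fin d) ℝ} (hq : q ∈ M.Wh k) :
    M.testField q ∈ M.Vh0 k := by
  have hq' := fun T => hq T (Set.mem_univ T)
  refine ⟨⟨fun T i => ?_, fun e => ?_⟩, fun e he => if_pos he⟩
  · refine Submodule.smul_mem _ _ ?_
    have h1 := pderiv_mem_restrictTotalDegree (hq' T) i
    rw [MvPolynomial.mem_restrictTotalDegree] at h1 ⊢
    exact h1.trans (Nat.sub_le _ _)
  · dsimp only [testField]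
    split_ifs
    · exact Submodule.zero_mem _
    · exact Submodule.mem_sup_left ⟨_, fun i => Submodule.smul_mem _ _
        (Submodule.sum_mem _ fun T _ => Submodule.smul_mem _ _ (hq' T)), rfl⟩

theorem evalVec_testField (q : M.elems → MvPolynomial (Fin d) ℝ) (T : M.elems) (x : Pt d) :
    evalVec ((M.testField q).1 T) x = (-(M.meshSize ^ 2)) • gradPoly (q T) x :=
  evalVec_smul (-(M.meshSize ^ 2)) (fun i => MvPolynomial.pderiv i (q T)) x

open scoped Classical in
theorem testField_face_apply (q : M.elems → MvPolynomial (Fin d) ℝ) (e : M.faces) {x : Pt d}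
    (hx : x ∈ (e : Set (Pt d))) : (M.testField q).2 e x =
      if (e : Set (Pt d)) ⊆ frontier Ω then 0 else M.meshSize • M.jump q e x := by
  dsimp only [testField]
  split_ifs
  · rfl
  · rw [Set.indicator_of_mem hx, evalVec_smul, evalVec_jumpPoly]

open scoped Classical in
/-- The square of the `L²` norm of the jump across `e`, set to zero on boundary faces. -/
def jumpSq (q : M.elems → MvPolynomial (Fin d) ℝ) (e : M.faces) : ℝ :=
  if (e : Set (Pt d)) ⊆ frontier Ω then 0 else
    faceIntegral (e : Set (Pt d)) fun x => ‖M.jump q e x‖ ^ 2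

theorem jumpSq_nonneg (q : M.elems → MvPolynomial (Fin d) ℝ) (e : M.faces) :
    0 ≤ M.jumpSq q e := by
  unfold jumpSq
  split_ifs
  · exact le_rfl
  · exact faceIntegral_nonneg fun x => sq_nonneg _

theorem meshSize_nonneg : 0 ≤ M.meshSize := Real.iSup_nonneg fun _ => Metric.diam_nonneg

theorem normW_sq (q : M.elems → MvPolynomial (Fin d) ℝ) : M.normW q ^ 2 =
    M.meshSize * ∑ e, M.jumpSq q e +
      M.meshSize ^ 2 * ∑ T : M.elems, ∫ x in (T : Set (Pt d)), ‖gradPoly (q T) x‖ ^ 2 := by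
  classical
  have h1 : ∑ e, M.jumpSq q e = ∑ e ∈ M.interiorFaces,
      faceIntegral (e : Set (Pt d)) (fun x => ‖M.jump q e x‖ ^ 2) := by
    rw [interiorFaces, Finset.sum_filter]
    refine Finset.sum_congr rfl fun e _ => ?_
    rw [jumpSq, ite_not]
  rw [normW, ← h1, Real.sq_sqrt]
  have h2 := M.meshSize_nonneg
  have h3 : 0 ≤ ∑ e, M.jumpSq q e := Finset.sum_nonneg fun e _ => M.jumpSq_nonneg q e
  have h4 : 0 ≤ ∑ T : M.elems, ∫ x in (T : Set (Pt d)), ‖gradPoly (q T) x‖ ^ 2 :=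
    Finset.sum_nonneg fun T _ => integral_nonneg fun x => sq_nonneg _
  positivity

theorem sum_facesOf_comm (f : M.elems → M.faces → ℝ) :
    ∑ T : M.elems, ∑ e ∈ M.facesOf T, f T e = ∑ e : M.faces, ∑ T ∈ M.elemsOf e, f T e :=
  Finset.sum_comm' fun T e => by simp [mem_facesOf, mem_elemsOf]

/-- Since `v_b` is single-valued, collecting the terms at a face `e` pairs it with `∑_T q|_T n_T`,
which is the jump; the volume terms give `h² ‖∇q‖²` directly. -/
theorem bForm_testField {k : ℕ} {q : M.elems → MvPolynomial (Fin d) ℝ} (hq : q ∈ M.Wh k) :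
    M.bForm k (M.testField q) q = M.normW q ^ 2 := by
  rw [M.bForm_eq (M.testField_mem_Vh0 hq).1 hq, Finset.sum_add_distrib, sum_facesOf_comm, normW_sq,
    add_comm, Finset.mul_sum, Finset.mul_sum]
  congr 1
  · refine Finset.sum_congr rfl fun e _ => ?_
    have he := M.face_polytope e e.2
    have hv := M.continuousOn_of_mem_Vh (M.testField_mem_Vh0 hq).1 e
    have h1 : ∑ T ∈ M.elemsOf e, faceIntegral (e : Set (Pt d)) (fun x =>
        inner ℝ ((M.testField q).2 e x) (outwardNormal (T : Set (Pt d)) e) * evalPoly (q T) x) =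
        faceIntegral (e : Set (Pt d)) fun x => inner ℝ ((M.testField q).2 e x) (M.jump q e x) := by
      rw [faceIntegral]
      simp only [jump, inner_sum, real_inner_smul_right]
      rw [integral_finsetSum]
      · simp only [faceIntegral, mul_comm]
      · intro T _
        have hc := continuous_evalPoly (q T)
        exact he.integrableOn_face (by fun_prop)
    rw [h1, jumpSq]
    split_ifs with hb
    · rw [mul_zero, faceIntegral_congr (g := fun _ => 0 * 0) he, faceIntegral_const_mul, zero_mul]
      intro x hx
      rw [M.testField_face_apply q e hx, if_pos hb, inner_zero_left, zero_mul]
    · rw [← faceIntegral_const_mul]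
      refine faceIntegral_congr he fun x hx => ?_
      rw [M.testField_face_apply q e hx, if_neg hb, real_inner_smul_left,
        real_inner_self_eq_norm_sq]
  · refine Finset.sum_congr rfl fun T _ => ?_
    rw [← integral_neg, ← integral_const_mul]
    refine integral_congr_ae (Eventually.of_forall fun x => ?_)
    simp only [evalVec_testField, real_inner_smul_left, real_inner_self_eq_norm_sq]
    ring

theorem bForm_zero {k : ℕ} {q : M.elems → MvPolynomial (Fin d) ℝ} (hq : q ∈ M.Wh k) :
    M.bForm k 0 q = 0 := by
  have h := M.bForm_add_smul (Submodule.zero_mem (M.Vh k)) (Submodule.zero_mem (M.Vh k)) hq 1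
  rw [smul_zero, add_zero, one_mul] at h
  linarith

/-- The linear field `x ↦ x₁ e₁` on all elements has positive norm. -/
theorem exists_normV_pos (hd : 0 < d) {k : ℕ} (hk : 1 ≤ k) [hne : Nonempty M.elems] :
    ∃ w ∈ M.Vh0 k, 0 < M.normV k w := by
  classical
  set i₀ : Fin d := ⟨0, hd⟩
  set w : M.WeakField := (fun _ i => if i = i₀ then MvPolynomial.X i₀ else 0, 0) with hw
  refine ⟨w, ⟨⟨fun T i => ?_, fun e => Submodule.zero_mem _⟩, fun e _ => rfl⟩, ?_⟩
  · simp only [hw]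
    split_ifs
    · rw [MvPolynomial.mem_restrictTotalDegree, MvPolynomial.totalDegree_X]
      exact hk
    · exact Submodule.zero_mem _
  · obtain ⟨T⟩ := hne
    have hT := M.elem_polytope T T.2
    have h1 : volume.real (T : Set (Pt d)) ≤
        ∫ x in (T : Set (Pt d)), ∑ i, ∑ j, strain (w.1 T) x i j ^ 2 := by
      have h2 : ∫ x in (T : Set (Pt d)), (1 : ℝ) = volume.real (T : Set (Pt d)) := by simp
      rw [← h2]
      refine setIntegral_mono (M.integrableOn_elem T continuous_const) (M.integrableOn_elem T
        (continuous_finsetSum _ fun i _ => continuous_finsetSum _ fun j _ =>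
          (continuous_strain _ i j).pow 2)) fun x => ?_
      -- One diagonal strain entry is identically `1`, so the strain term alone is at least `|T| >
      -- 0`.
      have h3 : strain (w.1 T) x i₀ i₀ ^ 2 = 1 := by
        simp [strain, hw, evalPoly]
        norm_num
      have h4 : strain (w.1 T) x i₀ i₀ ^ 2 ≤ ∑ j, strain (w.1 T) x i₀ j ^ 2 :=
        Finset.single_le_sum (f := fun j => strain (w.1 T) x i₀ j ^ 2)
          (fun j _ => sq_nonneg _) (Finset.mem_univ i₀)
      have h5 : ∑ j, strain (w.1 T) x i₀ j ^ 2 ≤ ∑ i, ∑ j, strain (w.1 T) x i j ^ 2 :=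
        Finset.single_le_sum (f := fun i => ∑ j, strain (w.1 T) x i j ^ 2)
          (fun i _ => Finset.sum_nonneg fun j _ => sq_nonneg _) (Finset.mem_univ i₀)
      exact h3.symm.trans_le (h4.trans h5)
    have hpos : 0 < volume.real (T : Set (Pt d)) :=
      ENNReal.toReal_pos hT.volume_pos.ne' hT.isCompact.measure_ne_top
    have h6 : 0 < M.normVSq k w T :=
      add_pos_of_pos_of_nonneg (hpos.trans_le h1) (M.faceTerms_nonneg k w T)
    refine Real.sqrt_pos.2 (h6.trans_le ?_)
    exact Finset.single_le_sum (f := fun T => M.normVSq k w T) (fun T _ => M.normVSq_nonneg k w T)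
      (Finset.mem_univ T)

theorem setIntegral_norm_gradPoly_sq (T : M.elems) (q : MvPolynomial (Fin d) ℝ) :
    ∫ x in (T : Set (Pt d)), ‖gradPoly q x‖ ^ 2 =
      ∑ i, ∫ x in (T : Set (Pt d)), evalPoly (MvPolynomial.pderiv i q) x ^ 2 := by
  have hint : ∀ i, IntegrableOn (fun x => evalPoly (MvPolynomial.pderiv i q) x ^ 2)
      (T : Set (Pt d)) := fun i => M.integrableOn_elem T ((continuous_evalPoly _).pow 2)
  rw [← integral_finsetSum _ fun i _ => hint i]
  exact integral_congr_ae (Eventually.of_forall fun x => norm_evalVec_sq _ x)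

/-- The local form of the estimate of the norm of the test field. -/
theorem normVSq_testField_le {k N : ℕ} {γ C : ℝ} {q : M.elems → MvPolynomial (Fin d) ℝ}
    {T : M.elems} (hC : 0 ≤ C) (hpos : 0 < Metric.diam (T : Set (Pt d)))
    (hγ : M.meshSize ≤ γ * Metric.diam (T : Set (Pt d))) (hN : (M.facesOf T).card ≤ N)
    (hinv : ∀ i j, Metric.diam (T : Set (Pt d)) ^ 2 * ∫ x in (T : Set (Pt d)),
      evalPoly (MvPolynomial.pderiv j (MvPolynomial.pderiv i (q T))) x ^ 2 ≤
        C * ∫ x in (T : Set (Pt d)), evalPoly (MvPolynomial.pderiv i (q T)) x ^ 2)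
    (htr : ∀ e ∈ M.facesOf T, ∀ i, Metric.diam (T : Set (Pt d)) * faceIntegral (e : Set (Pt d))
      (fun x => evalPoly (MvPolynomial.pderiv i (q T)) x ^ 2) ≤
        C * ∫ x in (T : Set (Pt d)), evalPoly (MvPolynomial.pderiv i (q T)) x ^ 2) :
    M.normVSq k (M.testField q) T ≤
      γ ^ 2 * C * (d + 2 * N) * (M.meshSize ^ 2 *
        ∫ x in (T : Set (Pt d)), ‖gradPoly (q T) x‖ ^ 2) +
      2 * γ * (M.meshSize * ∑ e ∈ M.facesOf T, M.jumpSq q e) := by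
  have hG := M.setIntegral_norm_gradPoly_sq T (q T)
  set h := Metric.diam (T : Set (Pt d))
  set H := M.meshSize with hH
  set G := ∫ x in (T : Set (Pt d)), ‖gradPoly (q T) x‖ ^ 2
  have hH0 : 0 ≤ H := M.meshSize_nonneg
  have hG0 : 0 ≤ G := integral_nonneg fun x => sq_nonneg _
  have hHh : H ^ 2 ≤ γ ^ 2 * h ^ 2 := by
    rw [← mul_pow]
    exact pow_le_pow_left₀ hH0 hγ 2
  -- Squares of `v₀` carry `H ^ 4`, and the inverse and trace inequalities cost `h⁻²`.
  -- Quasi-uniformity turns `H ^ 4 / h ^ 2` into `γ ^ 2 * H ^ 2`, the weight of `‖∇q‖²` in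
  -- `|||q|||₀²`.
  have hcancel : ∀ X c : ℝ, 0 ≤ c → h ^ 2 * X ≤ H ^ 4 * c → X ≤ γ ^ 2 * (H ^ 2 * c) := by
    intro X c hc hX
    refine le_of_mul_le_mul_left (hX.trans ?_) (pow_pos hpos 2)
    nlinarith [mul_le_mul_of_nonneg_right hHh (mul_nonneg (sq_nonneg H) hc)]
  -- the strain
  have hstrain : ∫ x in (T : Set (Pt d)), ∑ i, ∑ j, strain ((M.testField q).1 T) x i j ^ 2 ≤
      γ ^ 2 * (H ^ 2 * (C * d * G)) := by
    refine hcancel _ _ (by positivity) ?_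
    set D : Fin d → Fin d → ℝ := fun i j => ∫ x in (T : Set (Pt d)),
      evalPoly (MvPolynomial.pderiv j (MvPolynomial.pderiv i (q T))) x ^ 2 with hD
    have hint : ∀ i j, IntegrableOn (fun x =>
        evalPoly (MvPolynomial.pderiv j (MvPolynomial.pderiv i (q T))) x ^ 2) (T : Set (Pt d)) :=
      fun i j => M.integrableOn_elem T ((continuous_evalPoly _).pow 2)
    have hint' : ∀ i j, IntegrableOn (fun x => strain ((M.testField q).1 T) x i j ^ 2)
        (T : Set (Pt d)) := fun i j => M.integrableOn_elem T ((continuous_strain _ i j).pow 2)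
    have h1 : ∀ i j, ∫ x in (T : Set (Pt d)), strain ((M.testField q).1 T) x i j ^ 2 ≤
        H ^ 4 / 2 * (D i j + D j i) := by
      intro i j
      rw [hD, ← integral_add (hint i j) (hint j i), ← integral_const_mul]
      refine setIntegral_mono (hint' i j) (((hint i j).add (hint j i)).const_mul _) fun x => ?_
      simp only [strain, testField, Matrix.of_apply, Derivation.map_smul, evalPoly_smul, ← hH]
      set a := evalPoly (MvPolynomial.pderiv j (MvPolynomial.pderiv i (q T))) x
      set b := evalPoly (MvPolynomial.pderiv i (MvPolynomial.pderiv j (q T))) x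
      nlinarith [mul_nonneg (pow_nonneg hH0 4) (sq_nonneg (a - b))]
    have h2 : ∫ x in (T : Set (Pt d)), ∑ i, ∑ j, strain ((M.testField q).1 T) x i j ^ 2 =
        ∑ i, ∑ j, ∫ x in (T : Set (Pt d)), strain ((M.testField q).1 T) x i j ^ 2 := by
      rw [integral_finsetSum _ fun i _ => integrable_finsetSum _ fun j _ => hint' i j]
      exact Finset.sum_congr rfl fun i _ => integral_finsetSum _ fun j _ => hint' i j
    have h3 : h ^ 2 * ∑ i, ∑ j, D i j ≤ C * d * G := by
      rw [hG, Finset.mul_sum, Finset.mul_sum]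
      refine Finset.sum_le_sum fun i _ => ?_
      rw [Finset.mul_sum]
      refine (Finset.sum_le_sum fun j _ => hinv i j).trans_eq ?_
      rw [Finset.sum_const, Finset.card_univ, Fintype.card_fin, nsmul_eq_mul]
      ring
    have h4 : ∑ i, ∑ j, H ^ 4 / 2 * (D i j + D j i) = H ^ 4 * ∑ i, ∑ j, D i j := by
      simp only [← Finset.mul_sum, Finset.sum_add_distrib]
      rw [Finset.sum_comm (f := fun i j => D j i)]
      ring
    rw [h2]
    calc h ^ 2 * ∑ i, ∑ j, ∫ x in (T : Set (Pt d)), strain ((M.testField q).1 T) x i j ^ 2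
        ≤ h ^ 2 * ∑ i, ∑ j, H ^ 4 / 2 * (D i j + D j i) := by
          refine mul_le_mul_of_nonneg_left ?_ (sq_nonneg h)
          exact Finset.sum_le_sum fun i _ => Finset.sum_le_sum fun j _ => h1 i j
      _ = H ^ 4 * (h ^ 2 * ∑ i, ∑ j, D i j) := by rw [h4]; ring
      _ ≤ H ^ 4 * (C * d * G) := mul_le_mul_of_nonneg_left h3 (by positivity)
  -- the faces
  have hface : ∀ e ∈ M.facesOf T, h⁻¹ * faceIntegral (e : Set (Pt d)) (fun x =>
      ‖faceProj k (e : Set (Pt d)) (evalVec ((M.testField q).1 T)) x -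
        (M.testField q).2 e x‖ ^ 2) ≤
      2 * (γ ^ 2 * (H ^ 2 * (C * G))) + 2 * γ * (H * M.jumpSq q e) := by
    intro e heT
    have he := M.face_polytope e e.2
    have hgc := fun i => continuous_evalPoly (MvPolynomial.pderiv i (q T))
    have hcv : ContinuousOn ((M.testField q).2 e) (e : Set (Pt d)) := by
      have hj := M.continuous_jump q e
      have hc : Continuous fun x => M.meshSize • M.jump q e x := by fun_prop
      by_cases hb : (e : Set (Pt d)) ⊆ frontier Ω
      · exact continuousOn_const.congr fun x hx => (M.testField_face_apply q e hx).trans (if_pos hb)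
      · exact hc.continuousOn.congr fun x hx => (M.testField_face_apply q e hx).trans (if_neg hb)
    -- No cancellation between `Q_b v₀` and `v_b` is used: each is bounded separately, the first by
    -- contractivity of the projection and the trace inequality.
    have h1 := faceIntegral_norm_faceProj_sub_sq_le (k := k) he
      (continuous_evalVec ((M.testField q).1 T)).continuousOn hcv
    have h2 : faceIntegral (e : Set (Pt d)) (fun x => ‖evalVec ((M.testField q).1 T) x‖ ^ 2) =
        H ^ 4 * ∑ i, faceIntegral (e : Set (Pt d)) (fun x =>
          evalPoly (MvPolynomial.pderiv i (q T)) x ^ 2) := by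
      have hint : ∀ i, IntegrableOn (fun x => evalPoly (MvPolynomial.pderiv i (q T)) x ^ 2)
          (e : Set (Pt d)) (Measure.euclideanHausdorffMeasure (d - 1)) := fun i =>
        he.integrableOn_face ((hgc i).pow 2).continuousOn
      simp only [faceIntegral]
      rw [← integral_finsetSum _ fun i _ => hint i, ← integral_const_mul]
      refine integral_congr_ae (Eventually.of_forall fun x => ?_)
      simp only [evalVec_testField, gradPoly, norm_smul, mul_pow, norm_evalVec_sq, norm_neg, norm_pow,
        Real.norm_eq_abs, ← hH, sq_abs]
      rw [← pow_mul]
    have h3 : h * ∑ i, faceIntegral (e : Set (Pt d)) (fun x =>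
        evalPoly (MvPolynomial.pderiv i (q T)) x ^ 2) ≤ C * G := by
      rw [hG, Finset.mul_sum, Finset.mul_sum]
      exact Finset.sum_le_sum fun i _ => htr e heT i
    have h4 : h⁻¹ * faceIntegral (e : Set (Pt d))
        (fun x => ‖evalVec ((M.testField q).1 T) x‖ ^ 2) ≤ γ ^ 2 * (H ^ 2 * (C * G)) := by
      refine hcancel _ _ (by positivity) ?_
      rw [h2]
      calc _ = H ^ 4 * (h * ∑ i, faceIntegral (e : Set (Pt d)) (fun x =>
            evalPoly (MvPolynomial.pderiv i (q T)) x ^ 2)) := by field_simp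
        _ ≤ _ := mul_le_mul_of_nonneg_left h3 (by positivity)
    have h5 : faceIntegral (e : Set (Pt d)) (fun x => ‖(M.testField q).2 e x‖ ^ 2) =
        H ^ 2 * M.jumpSq q e := by
      rw [jumpSq]
      split_ifs with hb
      · rw [mul_zero, faceIntegral_congr (g := fun _ => 0 * 0) he, faceIntegral_const_mul, zero_mul]
        intro x hx
        rw [M.testField_face_apply q e hx, if_pos hb]
        simp
      · rw [← faceIntegral_const_mul]
        refine faceIntegral_congr he fun x hx => ?_
        rw [M.testField_face_apply q e hx, if_neg hb, norm_smul, mul_pow, Real.norm_eq_abs, sq_abs]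
    have h6 : h⁻¹ * (H ^ 2 * M.jumpSq q e) ≤ γ * (H * M.jumpSq q e) := by
      rw [inv_mul_le_iff₀ hpos]
      nlinarith [mul_le_mul_of_nonneg_right hγ (mul_nonneg hH0 (M.jumpSq_nonneg q e))]
    rw [h5] at h1
    have h7 := mul_le_mul_of_nonneg_left h1 (inv_nonneg.2 hpos.le)
    linarith
  have hsum : h⁻¹ * ∑ e ∈ M.facesOf T, faceIntegral (e : Set (Pt d)) (fun x =>
      ‖faceProj k (e : Set (Pt d)) (evalVec ((M.testField q).1 T)) x -
        (M.testField q).2 e x‖ ^ 2) ≤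
      N * (2 * (γ ^ 2 * (H ^ 2 * (C * G)))) + 2 * γ * (H * ∑ e ∈ M.facesOf T, M.jumpSq q e) := by
    rw [Finset.mul_sum]
    refine (Finset.sum_le_sum hface).trans ?_
    rw [Finset.sum_add_distrib, Finset.sum_const, nsmul_eq_mul, ← Finset.mul_sum, ← Finset.mul_sum]
    gcongr
  unfold normVSq
  linarith

theorem normW_nonneg (q : M.elems → MvPolynomial (Fin d) ℝ) : 0 ≤ M.normW q := Real.sqrt_nonneg _

/-- The norm of the test field is controlled by `|||q|||₀`. -/
theorem exists_normV_testField_le (hd : 0 < d) (k : ℕ) {ρ : ℝ} (γ : ℝ) (hρ : 0 < ρ) (N : ℕ) :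
    ∃ K > 0, ∀ {Ω : Set (Pt d)} (M : PolyMesh Ω), M.IsShapeRegular ρ N → M.IsQuasiUniform γ →
      ∀ q ∈ M.Wh k, M.normV k (M.testField q) ≤ K * M.normW q := by
  obtain ⟨C, hC, hC'⟩ := exists_inverse_trace_bound hd (k - 1) hρ
  -- The `4 * |γ|` is the local factor `2 * γ` doubled, as each face is counted by at most two
  -- elements; `|γ|` because `γ` may have any sign, and `+ 1` for positivity.
  set A := γ ^ 2 * C * (d + 2 * N) + 4 * |γ| + 1 with hA
  have hA0 : 0 < A := by positivity
  refine ⟨Real.sqrt A, Real.sqrt_pos.2 hA0, fun {Ω} M hreg hqu q hq => ?_⟩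
  have hq' := fun T => hq T (Set.mem_univ T)
  have hH := M.meshSize_nonneg
  have hJ := fun e => M.jumpSq_nonneg q e
  have hloc : ∀ T : M.elems, _ := fun T => M.normVSq_testField_le (k := k) (q := q) hC.le
    ((M.elem_polytope T T.2).diam_pos hd) (hqu T) (hreg T).2
    (fun i j => (hC' T (M.elem_polytope T T.2) (hreg T).1 _
      (pderiv_mem_restrictTotalDegree (hq' T) i)).1 j)
    (fun e he i => (hC' T (M.elem_polytope T T.2) (hreg T).1 _
      (pderiv_mem_restrictTotalDegree (hq' T) i)).2 e (M.face_subset_elem (M.mem_facesOf.1 he))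
      (M.face_polytope e e.2))
  have hsum := Finset.sum_le_sum fun T (_ : T ∈ Finset.univ) => hloc T
  rw [← normV_sq, Finset.sum_add_distrib, ← Finset.mul_sum, ← Finset.mul_sum, ← Finset.mul_sum,
    ← Finset.mul_sum, sum_facesOf_comm] at hsum
  have hcard : ∑ e : M.faces, ∑ _T ∈ M.elemsOf e, M.jumpSq q e ≤ 2 * ∑ e, M.jumpSq q e := by
    rw [Finset.mul_sum]
    refine Finset.sum_le_sum fun e _ => ?_
    rw [Finset.sum_const, nsmul_eq_mul]
    exact mul_le_mul_of_nonneg_right (by exact_mod_cast M.card_elemsOf_le hd e) (hJ e)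
  refine le_of_sq_le_sq ?_ (mul_nonneg (Real.sqrt_nonneg _) (M.normW_nonneg q))
  rw [mul_pow, Real.sq_sqrt hA0.le, normW_sq]
  set S := ∑ e, M.jumpSq q e
  set S' := ∑ e : M.faces, ∑ _T ∈ M.elemsOf e, M.jumpSq q e
  set Q := M.meshSize ^ 2 * ∑ T : M.elems, ∫ x in (T : Set (Pt d)), ‖gradPoly (q T) x‖ ^ 2
  have hS : 0 ≤ S := Finset.sum_nonneg fun e _ => hJ e
  have hS' : 0 ≤ S' := Finset.sum_nonneg fun e _ => Finset.sum_nonneg fun _ _ => hJ e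
  have hQ : 0 ≤ Q := mul_nonneg (sq_nonneg _) (Finset.sum_nonneg fun T _ =>
    integral_nonneg fun x => sq_nonneg _)
  have hHS : 0 ≤ M.meshSize * S := mul_nonneg hH hS
  have h1 : 2 * γ * (M.meshSize * S') ≤ 2 * |γ| * (M.meshSize * (2 * S)) := by
    gcongr
    exact le_abs_self γ
  have h2 : 0 ≤ γ ^ 2 * C * (d + 2 * N) := by positivity
  nlinarith [mul_nonneg h2 hHS, mul_nonneg (abs_nonneg γ) hQ]

/-! ### From the test field to the supremum. -/

/-- If `b(v, q) > 0` then the supremum of the quotients is at least `b(v, q) / r` for every `r > 0`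
with `|||v||| ≤ r`: if `|||v||| = 0`, the quotients of small perturbations of `v` are unbounded. -/
theorem exists_quotient_ge (hd : 0 < d) {k : ℕ} (hk : 1 ≤ k) [Nonempty M.elems]
    {q : M.elems → MvPolynomial (Fin d) ℝ} (hq : q ∈ M.Wh k) {v : M.WeakField}
    (hv : v ∈ M.Vh0 k) (hb : 0 < M.bForm k v q) {r : ℝ} (hr : 0 < r) (hvr : M.normV k v ≤ r) :
    ∃ u ∈ M.Vh0 k, u ≠ 0 ∧ M.bForm k v q / r ≤ M.bForm k u q / M.normV k u := by
  have hne : ∀ u : M.WeakField, 0 < M.bForm k u q → u ≠ 0 := by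
    rintro u hu rfl
    exact hu.ne' (M.bForm_zero hq)
  -- If `|||v||| = 0`, the quotient of `v` is `0` by the convention for division by zero, so `v`
  -- must be replaced by some `v + t • w` of positive norm.
  rcases (M.normV_nonneg k v).eq_or_lt with h0 | h0
  swap
  · exact ⟨v, hv, hne v hb, div_le_div_of_nonneg_left hb.le h0 hvr⟩
  obtain ⟨w, hw, hw0⟩ := M.exists_normV_pos hd hk
  have hform := fun t => M.bForm_add_smul hv.1 hw.1 hq t
  generalize M.bForm k v q = B at *
  generalize M.bForm k w q = b at *
  obtain ⟨c, hc⟩ : ∃ c, c = Real.sqrt 2 * M.normV k w := ⟨_, rfl⟩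
  have hc0 : 0 < c := hc ▸ mul_pos (Real.sqrt_pos.2 two_pos) hw0
  -- Chosen so that `(B / r) t c + t |b| + t = B`. As `|||v + t w||| ≤ t c`, this leaves `(B / r)
  -- |||v + t w||| ≤ B + t b`, the numerator of the new quotient.
  obtain ⟨t, ht⟩ : ∃ t, t = B / (B / r * c + |b| + 1) := ⟨_, rfl⟩
  have hden : 0 < B / r * c + |b| + 1 := by positivity
  have ht0 : 0 < t := ht ▸ div_pos hb hden
  have htB : t * (B / r * c + |b| + 1) = B := by
    rw [ht, div_mul_cancel₀ _ hden.ne']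
  have hup : M.normV k (v + t • w) ≤ t * c := by
    have h1 := M.normV_linearCombination_sq_le hv.1 hw.1 1 t
    rw [one_smul, ← h0] at h1
    refine le_of_sq_le_sq (h1.trans_eq ?_) (by positivity)
    rw [hc, mul_pow, mul_pow, Real.sq_sqrt (by norm_num)]
    ring
  have hmem : v + t • w ∈ M.Vh0 k := Submodule.add_mem _ hv (Submodule.smul_mem _ t hw)
  have hlow : 0 < M.normV k (v + t • w) := by
    refine (M.normV_nonneg k _).lt_of_ne fun h => ?_
    -- `w` is a combination of `v + t • w` and `v`; if both had norm zero, so would `w`.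
    have h1 := M.normV_linearCombination_sq_le hmem.1 hv.1 t⁻¹ (-t⁻¹)
    have h2 : t⁻¹ • (v + t • w) + (-t⁻¹) • v = w := by
      rw [smul_add, smul_smul, inv_mul_cancel₀ ht0.ne', one_smul]
      module
    rw [h2, ← h, ← h0] at h1
    have h3 := pow_pos hw0 2
    norm_num at h1
    linarith
  have hge : B / r * (t * c) + t ≤ B + t * b := by
    have h1 : 0 ≤ t * (|b| + b) := mul_nonneg ht0.le (by linarith [neg_abs_le b])
    linarith
  have hBr : 0 < B / r := by positivity
  have hmul : B / r * M.normV k (v + t • w) ≤ B / r * (t * c) :=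
    mul_le_mul_of_nonneg_left hup hBr.le
  refine ⟨v + t • w, hmem, hne _ ?_, ?_⟩
  · rw [hform t]
    have : 0 < B / r * (t * c) := by positivity
    linarith
  · rw [le_div_iff₀ hlow, hform t]
    linarith

end PolyMesh
end WGElasticity

end

theorem mainTheorem5 (d k : ℕ) (hd : d = 2 ∨ d = 3) (hk : 1 ≤ k)
    (ρ γ : ℝ) (hρ : 0 < ρ) (N : ℕ) :
    ∃ β : ℝ, 0 < β ∧
      ∀ Ω : Set (WGElasticity.Pt d), IsOpen Ω → Bornology.IsBounded Ω → IsConnected Ω →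
      ∀ M : WGElasticity.PolyMesh Ω, M.IsShapeRegular ρ N → M.IsQuasiUniform γ →
      ∀ q ∈ M.Wh0 k,
        ((β * M.normW q : ℝ) : EReal) ≤
          ⨆ v : {v : M.WeakField // v ∈ M.Vh0 k ∧ v ≠ 0},
            ((M.bForm k v q / M.normV k v : ℝ) : EReal) := by
  have hd0 : 0 < d := by omega
  obtain ⟨K, hK, hK'⟩ := WGElasticity.PolyMesh.exists_normV_testField_le hd0 k γ hρ N
  refine ⟨K⁻¹, inv_pos.2 hK, fun Ω _ _ hΩ M hreg hqu q hq => ?_⟩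
  have hne := M.elems_nonempty hΩ.nonempty
  -- The supremum is taken in `EReal`, so no boundedness is at stake and a single good field
  -- suffices.
  suffices h : ∃ u ∈ M.Vh0 k, u ≠ 0 ∧ K⁻¹ * M.normW q ≤ M.bForm k u q / M.normV k u by
    obtain ⟨u, hu, hu0, hle⟩ := h
    exact le_iSup_of_le ⟨u, hu, hu0⟩ (EReal.coe_le_coe_iff.2 hle)
  rcases (M.normW_nonneg q).eq_or_lt with h0 | h0
  -- If `|||q|||₀ = 0`, a nonzero field with nonnegative quotient is enough: `w` or `-w`, according
  -- to the sign of `b(w, q)`.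
  · obtain ⟨w, hw, hw0⟩ := M.exists_normV_pos hd0 hk
    have hform : ∀ t : ℝ, M.bForm k (t • w) q = t * M.bForm k w q := by
      intro t
      have h1 := M.bForm_add_smul (Submodule.zero_mem _) hw.1 hq.1 t
      rwa [zero_add, M.bForm_zero hq.1, zero_add] at h1
    have hw_ne : w ≠ 0 := by
      rintro rfl
      have h1 := M.normV_linearCombination_sq_le (Submodule.zero_mem (M.Vh k))
        (Submodule.zero_mem (M.Vh k)) 0 0
      rw [smul_zero, add_zero] at h1
      nlinarith [pow_pos hw0 2]
    rw [← h0, mul_zero]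
    rcases le_total 0 (M.bForm k w q) with hb | hb
    · exact ⟨w, hw, hw_ne, div_nonneg hb hw0.le⟩
    · refine ⟨(-1 : ℝ) • w, Submodule.smul_mem _ _ hw, smul_ne_zero (by norm_num) hw_ne, ?_⟩
      rw [hform]
      exact div_nonneg (by linarith) (M.normV_nonneg k _)
  · have hb := M.bForm_testField hq.1
    -- Taken with `r = K |||q|||₀`, for which `b(v, q) / r = |||q|||₀² / r = K⁻¹ |||q|||₀`.
    obtain ⟨u, hu, hu0, hle⟩ := M.exists_quotient_ge hd0 hk hq.1 (M.testField_mem_Vh0 hq.1)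
      (by rw [hb]; positivity) (mul_pos hK h0) (hK' M hreg hqu q hq.1)
    refine ⟨u, hu, hu0, le_trans (le_of_eq ?_) hle⟩
    rw [hb]
    field_simp
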